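/- Setup. Let $X$ be a finite weighted $d$-partite simplicial complex, i.e. a probability distribution $\mu$ on $\Omega_1\times\cdots\times\Omega_d$ with all $\Omega_i$ finite; $X(d)$ is the support of $\mu$ and $x\sim X(d)$ means $x\sim\mu$. All expectations, norms and inner products $\langle f,g\rangle=\mathbb{E}[fg]$ are with respect to $\mu$. For $T\subseteq[d]$ and $y\in X(d)$, the link of $y_T$ is the distribution of $x\sim X(d)$ conditioned on $x_T=y_T$. The complex $X$ is a $\gamma$-product if for every $T\subseteq[d]$ (including $T=\emptyset$), every $y\in X(d)$ and all distinct $i,j\notin T$, the bipartite walk $A_{i,j}\,g(b)=\mathbb{E}[g(x_i)\mid x_j=b]$ in the link of $y_T$ satisfies $\lambda_2(A_{i,j})\le\gamma$, where $\lambda_2(A_{i,j})=\lVert A_{i,j}-\Pi_{i,j}\rVert_2$ is its second largest singular value, and $\Pi_{i,j}\,g=\mathbb{E}[g(x_i)]$, both taken in that link. For $f:X(d)\to\mathbb{R}$ write $E_Tf(y)=\mathbb{E}[f(x)\mid x_T=y_T]$, let $f^{=S}=\sum_{T\subseteq S}(-1)^{|S\setminus T|}E_Tf$ be the Efron–Stein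 components of $f$, and let $\mathbf{I}[f]=\sum_{i\in[d]}\langle f,\,f-E_{[d]\setminus\{i\}}f\rangle$ be its total influence. Proposition. There are absolute constants $c,C,K>0$ such that the following holds for every $d$. Let $X$ be a $d$-partite $\gamma$-product with $0\le\gamma\le 2^{-cd}$, let $\varepsilon\in(2^{Cd}\gamma,\,1/2)$, and let $f:X(d)\to\{\pm1\}$ satisfy $\mathrm{Var}(f)\ge .01$. Put $\ell=\mathbf{I}[f]/\varepsilon$. Then there is a family of sets $J_x\subseteq[d]$, $x\in X(d)$, such that 1. $|J_x|\le 2^{K\ell}$ for all $x$, and 2. $\mathbb{E}_{x\sim X(d)}\Big[\sum_{S\notin\mathcal{F}_x}f^{=S}(x)^2\Big]\le 3\varepsilon$, where $\mathcal{F}_x=\{S\subseteq[d]: S\subseteq J_x,\ |S|\le\ell\}$. -/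

import Mathlib

noncomputable section

/-- A finite weighted `d`-partite simplicial complex with colour classes `Ω 0, …, Ω (d-1)`, given as
a probability distribution on `∏ i, Ω i`. The top-level faces `X(d)` are the tuples of positive
weight. Functions on `X(d)` are written as functions on the whole product; their values
at tuples of weight zero never matter. -/
structure PartiteComplex (d : ℕ) (Ω : Fin d → Type*) [∀ i, Fintype (Ω i)] where
  weight : (∀ i, Ω i) → ℝ
  weight_nonneg : ∀ x, 0 ≤ weight x
  sum_weight : ∑ x, weight x = 1

namespace PartiteComplex

variable {d : ℕ} {Ω : Fin d → Type*} [∀ i, Fintype (Ω i)] (X : PartiteComplex d Ω)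

/-- `x` is a top-level face of `X`, that is `x ∈ X(d)`. -/
def IsFace (x : ∀ i, Ω i) : Prop := 0 < X.weight x

/-- `𝔼_{x ∼ X(d)} [f x]`. -/
def expect (f : (∀ i, Ω i) → ℝ) : ℝ := ∑ x, X.weight x * f x

/-- `⟨f, g⟩ = 𝔼 [f g]`. -/
def inner (f g : (∀ i, Ω i) → ℝ) : ℝ := X.expect fun x => f x * g x

/-- `Var(f) = 𝔼 [(f - 𝔼 f)²]`. -/
def variance (f : (∀ i, Ω i) → ℝ) : ℝ := X.expect fun x => (f x - X.expect f) ^ 2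

open Classical in
/-- `Pr_{x ∼ X(d)} [x ∈ B]`. -/
def prob (B : Set (∀ i, Ω i)) : ℝ := ∑ x, if x ∈ B then X.weight x else 0

open Classical in
/-- `𝔼_{x ∼ X(d)} [f x | x ∈ B]`, used for events of positive probability. -/
def condExpect (B : Set (∀ i, Ω i)) (f : (∀ i, Ω i) → ℝ) : ℝ :=
  (∑ x, if x ∈ B then X.weight x * f x else 0) / X.prob B

/-- The event `x_T = y_T`. -/
def cylinder (T : Finset (Fin d)) (y : ∀ i, Ω i) : Set (∀ i, Ω i) := {x | ∀ i ∈ T, x i = y i}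

theorem prob_cylinder_pos (T : Finset (Fin d)) (y : ∀ i, Ω i) (hy : X.IsFace y) :
    0 < X.prob (cylinder T y) := by
  classical
  refine Finset.sum_pos' (fun x _ => ?_) ⟨y, Finset.mem_univ y, ?_⟩
  · split_ifs
    · exact X.weight_nonneg x
    · exact le_rfl
  · have h : y ∈ cylinder T y := fun _ _ => rfl
    rw [if_pos h]
    exact hy

open Classical in
/-- The link of the face `y_T`: the distribution of `x ∼ X(d)` conditioned on `x_T = y_T`. It is kept
as a distribution on all coordinates; those in `T` are then constant, equal to `y_T`. -/
def link (T : Finset (Fin d)) (y : ∀ i, Ω i) (hy : X.IsFace y) : PartiteComplex d Ω where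
  weight x := if x ∈ cylinder T y then X.weight x / X.prob (cylinder T y) else 0
  weight_nonneg x := by
    split_ifs
    · exact div_nonneg (X.weight_nonneg x) (X.prob_cylinder_pos T y hy).le
    · exact le_rfl
  sum_weight := by
    have h := (X.prob_cylinder_pos T y hy).ne'
    have e : ∀ x, (if x ∈ cylinder T y then X.weight x / X.prob (cylinder T y) else 0)
        = (if x ∈ cylinder T y then X.weight x else 0) / X.prob (cylinder T y) := by
      intro x
      split_ifs <;> simp
    rw [Finset.sum_congr rfl fun x _ => e x, ← Finset.sum_div]
    exact div_self h

/-- The bipartite walk `A_{i,j}`, from functions on colour `i` to functions on colour `j`: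
`A_{i,j} g (b) = 𝔼 [g (x_i) | x_j = b]`. -/
def walk (i j : Fin d) (g : Ω i → ℝ) (b : Ω j) : ℝ :=
  X.condExpect {x | x j = b} fun x => g (x i)

/-- The stationary operator `Π_{i,j}`, sending `g` to the constant function `𝔼 [g (x_i)]`. -/
def stationary (i j : Fin d) (g : Ω i → ℝ) (_ : Ω j) : ℝ := X.expect fun x => g (x i)

/-- The `L²` norm of a function on colour `i`, with respect to the marginal of `X` on colour `i`. -/
def colourNorm (i : Fin d) (g : Ω i → ℝ) : ℝ := √(X.expect fun x => g (x i) ^ 2)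

/-- `λ₂(A_{i,j})`: the second largest singular value of the walk `A_{i,j}`, which is the `L²` operator
norm of `A_{i,j} - Π_{i,j}`. -/
def lambda₂ (i j : Fin d) : ℝ :=
  sInf {c : ℝ | 0 ≤ c ∧ ∀ g : Ω i → ℝ,
    X.colourNorm j (X.walk i j g - X.stationary i j g) ≤ c * X.colourNorm i g}

/-- `X` is a `γ`-product: `λ₂(A_{i,j}) ≤ γ` in every link, for every two distinct colours
outside the face that defines the link. (So the link has co-dimension at least two; the choice `T = ∅` is
`X` itself.) -/
def IsGammaProduct (γ : ℝ) : Prop :=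
  ∀ (T : Finset (Fin d)) (y : ∀ i, Ω i) (hy : X.IsFace y) (i j : Fin d),
    i ∉ T → j ∉ T → i ≠ j → (X.link T y hy).lambda₂ i j ≤ γ

/-- The averaging operator `E_T f (y) = 𝔼 [f x | x_T = y_T]`. -/
def average (T : Finset (Fin d)) (f : (∀ i, Ω i) → ℝ) (y : ∀ i, Ω i) : ℝ :=
  X.condExpect (cylinder T y) f

/-- The Laplacian `L_i f = f - E_{[d] ∖ {i}} f`. -/
def laplacian (i : Fin d) (f : (∀ i, Ω i) → ℝ) (x : ∀ i, Ω i) : ℝ :=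
  f x - X.average (Finset.univ.erase i) f x

/-- The total influence `I[f] = ∑ i, ⟨f, L_i f⟩`. -/
def totalInfluence (f : (∀ i, Ω i) → ℝ) : ℝ := ∑ i, X.inner f (X.laplacian i f)

/-- The Efron–Stein component `f^{=S} = ∑_{T ⊆ S} (-1)^{|S ∖ T|} E_T f`. -/
def efronStein (S : Finset (Fin d)) (f : (∀ i, Ω i) → ℝ) (x : ∀ i, Ω i) : ℝ :=
  ∑ T ∈ S.powerset, (-1) ^ (S \ T).card * X.average T f x

/-- The family `𝓕_x = {S : S ⊆ J_x, |S| ≤ ℓ}`, for `J = J_x`. -/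
def smallSubsets (J : Finset (Fin d)) (l : ℝ) : Set (Finset (Fin d)) :=
  {S | S ⊆ J ∧ (S.card : ℝ) ≤ l}

open Classical in
/-- `𝔼_x [∑_{S ∉ 𝓕_x} f^{=S}(x)²]`. -/
def massOutside (𝓕 : (∀ i, Ω i) → Set (Finset (Fin d))) (f : (∀ i, Ω i) → ℝ) : ℝ :=
  X.expect fun x => ∑ S : Finset (Fin d), if S ∈ 𝓕 x then 0 else X.efronStein S f x ^ 2

end PartiteComplex

end

/-! If the coordinates were independent, the Efron–Stein components would be orthogonal and the
noise operators would be products of commuting one-coordinate operators. In a `γ`-product both facts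
survive in `L²` up to a factor exponential in `d` times `γ`, which the hypotheses make negligible
against `ε`. The source is `IsGammaProduct.approxIndependent`: `⟨E_T u, E_T' v⟩` is close to `⟨E_{T
∩ T'} u, v⟩`.

The analytic engine is in `L⁴`. Multipliers `∑ (∏_{i ∈ S} b_i) f^{=S}` with `|b_i| ≤ 1/4` are nearly
compositions of one-coordinate `L⁴` contractions (`expect_multiplier_pow_four_le`). Taking `b_i = ±
1/4` and averaging over signs gives two Littlewood–Paley type bounds: the damped square function is
bounded in `L²` (`expect_squareFunction_sq_le`), and, with Bonami's inequality applied to the signs,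
`∑ (G_S)^{=S}` is controlled in `L⁴` by a weighted square function of the `G_S`
(`expect_sum_efronStein_pow_four_le`).

Let `J_x` collect the coordinates whose local influence `∑_{S ∋ i, |S| ≤ n} f^{=S}(x)²`, `n = ⌊ℓ⌋`,
is at least a threshold `τ`. It is small wherever the square function is at most `M`. The mass
outside comes from three sources: high degree, bounded by total influence
(`mul_sum_high_degree_le`); points with a large square function, bounded by its second moment; and
coordinates of small local influence (`expect_localInfluence_le`). For the last, the truncated
influence is `⟨f, H⟩` with `H = ∑ (G_S)^{=S}`, nearly `⟨L_i f, H⟩`. As `f = ±1`, the function `|L_i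
f|` is bounded and has mean equal to the influence of `i`, while the fourth moment of `H` is at most
a multiple of `τ` times the truncated influence itself, up to error, and so is absorbed. -/

noncomputable section

open Finset

/-! ### Möbius inversion over subsets -/

section Moebius

variable {ι M N : Type*} [DecidableEq ι] [AddCommGroup M] [Module ℝ M] [AddCommGroup N] [Module ℝ N]

/-- The Möbius transform `∑_{T ⊆ S} (-1)^{|S ∖ T|} F T`. -/
def moebius (F : Finset ι → M) (S : Finset ι) : M :=
  ∑ T ∈ S.powerset, (-1 : ℝ) ^ (S \ T).card • F T

theorem moebius_congr {F G : Finset ι → M} {S : Finset ι} (h : ∀ T ⊆ S, F T = G T) :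
    moebius F S = moebius G S :=
  sum_congr rfl fun T hT => by rw [h T (mem_powerset.1 hT)]

theorem moebius_insert (F : Finset ι → M) {S : Finset ι} {a : ι} (ha : a ∉ S) :
    moebius F (insert a S) = moebius (fun T => F (insert a T)) S - moebius F S := by
  unfold moebius
  rw [sum_powerset_insert ha, add_comm, sub_eq_add_neg, ← sum_neg_distrib]
  congr 1
  · refine sum_congr rfl fun T hT => ?_
    rw [insert_sdiff_insert, sdiff_insert_of_notMem ha]
  · refine sum_congr rfl fun T hT => ?_
    have haT : a ∉ T := fun h => ha (mem_powerset.1 hT h)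
    rw [insert_sdiff_of_notMem _ haT, card_insert_of_notMem (by simp [ha]), pow_succ]
    simp

theorem sum_moebius (F : Finset ι → M) (V : Finset ι) :
    ∑ S ∈ V.powerset, moebius F S = F V := by
  induction V using Finset.induction_on generalizing F with
  | empty => simp [moebius]
  | insert a V ha ih =>
    rw [sum_powerset_insert ha, ← sum_add_distrib, ← ih fun T => F (insert a T)]
    refine sum_congr rfl fun S hS => ?_
    rw [moebius_insert F fun h => ha (mem_powerset.1 hS h)]
    abel

/-- The terms of `T` and `T ∪ {a}` carry opposite signs and cancel in pairs. -/
theorem moebius_eq_zero {F : Finset ι → M} {S : Finset ι} {a : ι} (ha : a ∈ S)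
    (h : ∀ T ⊆ S, F (insert a T) = F T) : moebius F S = 0 := by
  rw [← insert_erase ha, moebius_insert F (notMem_erase a S), sub_eq_zero]
  exact moebius_congr fun T hT => h T (hT.trans (erase_subset a S))

theorem map_moebius (L : M →ₗ[ℝ] N) (F : Finset ι → M) (S : Finset ι) :
    L (moebius F S) = moebius (fun T => L (F T)) S := by
  simp [moebius]

theorem moebius_apply {α : Type*} (F : Finset ι → α → ℝ) (S : Finset ι) (x : α) :
    moebius F S x = moebius (fun T => F T x) S := by
  simp [moebius]

theorem moebius_sub (F G : Finset ι → M) (S : Finset ι) :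
    moebius (fun T => F T - G T) S = moebius F S - moebius G S := by
  simp [moebius, smul_sub]

theorem abs_moebius_le {F : Finset ι → ℝ} {S : Finset ι} {B : ℝ} (h : ∀ T ⊆ S, |F T| ≤ B) :
    |moebius F S| ≤ 2 ^ S.card * B := by
  refine (abs_sum_le_sum_abs _ _).trans ((sum_le_card_nsmul _ _ B fun T hT => ?_).trans ?_)
  · simpa [abs_mul] using h T (mem_powerset.1 hT)
  · simp [card_powerset]

/-- The Möbius transform of `T ↦ q (T ∩ T')` in both variables is diagonal. -/
theorem moebius_moebius_inter (q : Finset ι → ℝ) (S : Finset ι) :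
    moebius (fun T => moebius (fun T' => q (T ∩ T')) S) S = moebius q S := by
  -- If `T` misses some `a ∈ S`, then `T ∩ T'` does not see whether `a ∈ T'`, so the inner transform
  -- cancels; only `T = S` survives.
  have h : ∀ T ⊆ S, T ≠ S → moebius (fun T' => q (T ∩ T')) S = 0 := by
    intro T hT hne
    obtain ⟨a, haS, haT⟩ := exists_of_ssubset (hT.ssubset_of_ne hne)
    exact moebius_eq_zero haS fun T' _ => by rw [inter_insert_of_notMem haT]
  rw [moebius, sum_eq_single_of_mem S (mem_powerset_self S)
    fun T hT hne => by rw [h T (mem_powerset.1 hT) hne, smul_zero], sdiff_self, bot_eq_empty,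
    card_empty, pow_zero, one_smul]
  exact moebius_congr fun T hT => by rw [inter_eq_right.2 hT]

end Moebius

/-! ### Walsh characters and hypercontractivity on the cube -/

section Walsh

variable {ι : Type*} [DecidableEq ι]

/-- The coordinate `i` of the sign vector which is `-1` exactly on `R`. -/
def sign (R : Finset ι) (i : ι) : ℝ := if i ∈ R then -1 else 1

/-- The Walsh character `∏_{i ∈ S} r_i` at the sign vector `r` which is `-1` exactly on `R`. -/
def walsh (R S : Finset ι) : ℝ := ∏ i ∈ S, sign R i

theorem abs_sign (R : Finset ι) (i : ι) : |sign R i| = 1 := by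
  unfold sign; split_ifs <;> simp

theorem abs_walsh (R S : Finset ι) : |walsh R S| = 1 := by
  simp [walsh, abs_prod, abs_sign]

theorem walsh_comm (R S : Finset ι) : walsh R S = walsh S R := by
  simp only [walsh, sign, prod_ite, prod_const, one_pow, mul_one]
  congr 2
  ext i
  simp [and_comm]

/-- After exchanging the roles of signs and sets, the sum factors over coordinates; one in the
symmetric difference contributes `1 - 1 = 0`. -/
theorem sum_walsh_mul_walsh [Fintype ι] (S S' : Finset ι) :
    ∑ R : Finset ι, walsh R S * walsh R S' = if S = S' then 2 ^ Fintype.card ι else 0 := by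
  have h := prod_add (fun i => sign S i * sign S' i) (fun _ => (1 : ℝ)) (univ : Finset ι)
  simp only [prod_const_one, mul_one, prod_mul_distrib, powerset_univ] at h
  rw [sum_congr rfl fun R _ => by rw [walsh_comm R S, walsh_comm R S']]
  unfold walsh
  rw [← h]
  split_ifs with hS
  · subst hS
    have : ∀ i, sign S i * sign S i + 1 = 2 := by
      intro i; unfold sign; split_ifs <;> norm_num
    simp [this]
  · obtain ⟨i, hi⟩ : ∃ i, ¬ (i ∈ S ↔ i ∈ S') := by
      by_contra! hc
      exact hS (Finset.ext hc)
    refine prod_eq_zero (mem_univ i) ?_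
    unfold sign
    by_cases h1 : i ∈ S <;> by_cases h2 : i ∈ S' <;> simp_all

theorem sum_sum_walsh_sq [Fintype ι] (c : Finset ι → ℝ) :
    ∑ R : Finset ι, (∑ S : Finset ι, walsh R S * c S) ^ 2
      = 2 ^ Fintype.card ι * ∑ S : Finset ι, c S ^ 2 := by
  have h : ∀ R : Finset ι, (∑ S : Finset ι, walsh R S * c S) ^ 2
      = ∑ S : Finset ι, ∑ S' : Finset ι, walsh R S * walsh R S' * (c S * c S') := by
    intro R
    rw [sq, sum_mul_sum]
    exact sum_congr rfl fun S _ => sum_congr rfl fun S' _ => by ring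
  rw [sum_congr rfl fun R _ => h R, sum_comm, mul_sum]
  refine sum_congr rfl fun S _ => ?_
  rw [sum_comm, sum_congr rfl fun S' _ => (sum_mul _ _ _).symm]
  simp only [sum_walsh_mul_walsh, ite_mul, zero_mul, sum_ite_eq, mem_univ, if_true]
  ring

theorem walsh_insert_left {R S : Finset ι} {a : ι} (ha : a ∉ S) :
    walsh (insert a R) S = walsh R S := by
  refine prod_congr rfl fun i hi => ?_
  have : i ≠ a := fun h => ha (h ▸ hi)
  simp [sign, this]

/-- Bonami's hypercontractive inequality, from `L²` to `L⁴`, on the discrete cube. -/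
theorem bonami (V : Finset ι) (c : Finset ι → ℝ) :
    ∑ R ∈ V.powerset, (∑ S ∈ V.powerset, (1 / 2) ^ S.card * walsh R S * c S) ^ 4
      ≤ 2 ^ V.card * (∑ S ∈ V.powerset, c S ^ 2) ^ 2 := by
  induction V using Finset.induction_on generalizing c with
  | empty => simp [walsh]; apply le_of_eq; ring
  | insert a V ha ih =>
    set P : Finset ι → ℝ := fun R => ∑ S ∈ V.powerset, (1 / 2) ^ S.card * walsh R S * c S
    set Q : Finset ι → ℝ := fun R =>
      ∑ S ∈ V.powerset, (1 / 2) ^ S.card * walsh R S * c (insert a S)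
    have e1 : ∀ R ∈ V.powerset, ∑ S ∈ (insert a V).powerset, (1 / 2) ^ S.card * walsh R S * c S
        = P R + 1 / 2 * Q R := by
      intro R hR
      have haR : a ∉ R := fun h => ha (mem_powerset.1 hR h)
      rw [sum_powerset_insert ha, mul_sum]
      congr 1
      refine sum_congr rfl fun S hS => ?_
      have haS : a ∉ S := fun h => ha (mem_powerset.1 hS h)
      rw [card_insert_of_notMem haS, walsh, prod_insert haS, ← walsh, sign, if_neg haR]
      ring
    have e2 : ∀ R ∈ V.powerset, ∑ S ∈ (insert a V).powerset,
        (1 / 2) ^ S.card * walsh (insert a R) S * c S = P R - 1 / 2 * Q R := by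
      intro R hR
      rw [sum_powerset_insert ha, mul_sum, sub_eq_add_neg, ← sum_neg_distrib]
      congr 1
      · refine sum_congr rfl fun S hS => ?_
        rw [walsh_insert_left fun h => ha (mem_powerset.1 hS h)]
      · refine sum_congr rfl fun S hS => ?_
        have haS : a ∉ S := fun h => ha (mem_powerset.1 hS h)
        rw [card_insert_of_notMem haS, walsh, prod_insert haS, ← walsh, walsh_insert_left haS,
          sign, if_pos (mem_insert_self a R)]
        ring
    rw [sum_powerset_insert (s := V) ha, ← sum_add_distrib,
      sum_congr rfl fun R hR => by rw [e1 R hR, e2 R hR],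
      sum_powerset_insert (s := V) ha, card_insert_of_notMem ha]
    have hP := ih c
    have hQ := ih fun S => c (insert a S)
    set α := ∑ S ∈ V.powerset, c S ^ 2
    set β := ∑ S ∈ V.powerset, c (insert a S) ^ 2
    have hα : 0 ≤ α := sum_nonneg fun _ _ => sq_nonneg _
    have hβ : 0 ≤ β := sum_nonneg fun _ _ => sq_nonneg _
    have hn : (0 : ℝ) ≤ 2 ^ V.card := by positivity
    -- The odd terms of `(P ± Q/2)⁴` cancel between the two signs of `a`. The remaining mixed term
    -- is bounded by Cauchy–Schwarz and both induction hypotheses.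
    have hPQ : ∑ R ∈ V.powerset, P R ^ 2 * Q R ^ 2 ≤ 2 ^ V.card * (α * β) := by
      refine le_of_sq_le_sq ?_ (by positivity)
      refine (sum_mul_sq_le_sq_mul_sq _ _ _).trans ?_
      calc _ = (∑ R ∈ V.powerset, P R ^ 4) * ∑ R ∈ V.powerset, Q R ^ 4 := by
            congr 1 <;> exact sum_congr rfl fun _ _ => by ring
        _ ≤ (2 ^ V.card * α ^ 2) * (2 ^ V.card * β ^ 2) :=
            mul_le_mul hP hQ (sum_nonneg fun _ _ => by positivity) (by positivity)
        _ = _ := by ring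
    calc _ = 2 * ∑ R ∈ V.powerset, P R ^ 4 + 3 * ∑ R ∈ V.powerset, P R ^ 2 * Q R ^ 2
          + 1 / 8 * ∑ R ∈ V.powerset, Q R ^ 4 := by
          simp only [mul_sum, ← sum_add_distrib]
          exact sum_congr rfl fun _ _ => by ring
      _ ≤ 2 * (2 ^ V.card * α ^ 2) + 3 * (2 ^ V.card * (α * β)) + 1 / 8 * (2 ^ V.card * β ^ 2) := by
          gcongr
      _ ≤ 2 ^ (V.card + 1) * (α + β) ^ 2 := by
          have : 0 ≤ 2 ^ V.card * (α * β + 15 / 8 * β ^ 2) := by positivity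
          rw [pow_succ (2 : ℝ) V.card]
          linarith

end Walsh

/-! ### Expectation and the `L²` structure -/

namespace PartiteComplex

theorem mem_cylinder_comm {d : ℕ} {Ω : Fin d → Type*} {T : Finset (Fin d)} {x y : ∀ i, Ω i} :
    x ∈ cylinder T y ↔ y ∈ cylinder T x :=
  ⟨fun h i hi => (h i hi).symm, fun h i hi => (h i hi).symm⟩

theorem cylinder_congr {d : ℕ} {Ω : Fin d → Type*} {T : Finset (Fin d)} {x y : ∀ i, Ω i} (h : ∀ i ∈ T, x i = y i) :
    cylinder T x = cylinder T y := by
  ext z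
  exact ⟨fun hz i hi => (hz i hi).trans (h i hi), fun hz i hi => (hz i hi).trans (h i hi).symm⟩

variable {d : ℕ} {Ω : Fin d → Type*} [∀ i, Fintype (Ω i)] (X : PartiteComplex d Ω)

theorem expect_mono {f g : (∀ i, Ω i) → ℝ} (h : ∀ x, X.IsFace x → f x ≤ g x) :
    X.expect f ≤ X.expect g := by
  refine sum_le_sum fun x _ => ?_
  rcases (X.weight_nonneg x).eq_or_lt with hx | hx
  · simp [← hx]
  · exact mul_le_mul_of_nonneg_left (h x hx) hx.le

theorem expect_congr {f g : (∀ i, Ω i) → ℝ} (h : ∀ x, X.IsFace x → f x = g x) :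
    X.expect f = X.expect g :=
  le_antisymm (X.expect_mono fun x hx => (h x hx).le) (X.expect_mono fun x hx => (h x hx).ge)

theorem expect_add (f g : (∀ i, Ω i) → ℝ) :
    X.expect (fun x => f x + g x) = X.expect f + X.expect g := by
  simp [expect, mul_add, sum_add_distrib]

theorem expect_sub (f g : (∀ i, Ω i) → ℝ) :
    X.expect (fun x => f x - g x) = X.expect f - X.expect g := by
  simp [expect, mul_sub, sum_sub_distrib]

theorem expect_const_mul (c : ℝ) (f : (∀ i, Ω i) → ℝ) :
    X.expect (fun x => c * f x) = c * X.expect f := by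
  simp only [expect, mul_sum]
  exact sum_congr rfl fun _ _ => by ring

theorem expect_const (c : ℝ) : X.expect (fun _ => c) = c := by
  simp [expect, ← sum_mul, X.sum_weight]

theorem expect_sum {κ : Type*} (s : Finset κ) (f : κ → (∀ i, Ω i) → ℝ) :
    X.expect (fun x => ∑ k ∈ s, f k x) = ∑ k ∈ s, X.expect (f k) := by
  simp only [expect, mul_sum]
  exact sum_comm

theorem expect_nonneg {f : (∀ i, Ω i) → ℝ} (h : ∀ x, X.IsFace x → 0 ≤ f x) : 0 ≤ X.expect f :=
  (X.expect_const 0).ge.trans (X.expect_mono h)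

theorem inner_comm (f g : (∀ i, Ω i) → ℝ) : X.inner f g = X.inner g f := by
  simp only [inner, mul_comm]

/-- `⟨f, g⟩` as a linear function of `f`. -/
def innerLM (g : (∀ i, Ω i) → ℝ) : ((∀ i, Ω i) → ℝ) →ₗ[ℝ] ℝ where
  toFun f := X.inner f g
  map_add' f f' := by simp only [inner, Pi.add_apply, add_mul, expect_add]
  map_smul' c f := by
    simp only [inner, Pi.smul_apply, smul_eq_mul, mul_assoc, expect_const_mul, RingHom.id_apply]

theorem inner_sub_left (f f' g : (∀ i, Ω i) → ℝ) :
    X.inner (f - f') g = X.inner f g - X.inner f' g := (X.innerLM g).map_sub f f'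

theorem inner_sub_right (f g g' : (∀ i, Ω i) → ℝ) :
    X.inner f (g - g') = X.inner f g - X.inner f g' := by
  rw [inner_comm, inner_sub_left, X.inner_comm g, X.inner_comm g']

theorem inner_sum_left {κ : Type*} (s : Finset κ) (f : κ → (∀ i, Ω i) → ℝ) (g : (∀ i, Ω i) → ℝ) :
    X.inner (∑ k ∈ s, f k) g = ∑ k ∈ s, X.inner (f k) g := map_sum (X.innerLM g) f s

theorem inner_congr {f f' g g' : (∀ i, Ω i) → ℝ} (h : ∀ x, X.IsFace x → f x = f' x)
    (h' : ∀ x, X.IsFace x → g x = g' x) : X.inner f g = X.inner f' g' :=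
  X.expect_congr fun x hx => by rw [h x hx, h' x hx]

/-- The isometry of `L²(X)` into a Euclidean space. -/
def toEuclidean : ((∀ i, Ω i) → ℝ) →ₗ[ℝ] EuclideanSpace ℝ (∀ i, Ω i) where
  toFun f := WithLp.toLp 2 fun x => √(X.weight x) * f x
  map_add' f g := by ext x; simp [mul_add]
  map_smul' c f := by ext x; simp; ring

/-- The `L²` norm. -/
def norm₂ (f : (∀ i, Ω i) → ℝ) : ℝ := ‖X.toEuclidean f‖

theorem inner_eq_toEuclidean (f g : (∀ i, Ω i) → ℝ) :
    X.inner f g = Inner.inner ℝ (X.toEuclidean f) (X.toEuclidean g) := by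
  simp only [inner, expect, toEuclidean, LinearMap.coe_mk, AddHom.coe_mk, PiLp.inner_apply,
    RCLike.inner_apply, conj_trivial]
  refine sum_congr rfl fun x _ => ?_
  nth_rewrite 1 [← Real.mul_self_sqrt (X.weight_nonneg x)]
  ring

theorem norm₂_nonneg (f : (∀ i, Ω i) → ℝ) : 0 ≤ X.norm₂ f := norm_nonneg _

theorem norm₂_sq (f : (∀ i, Ω i) → ℝ) : X.norm₂ f ^ 2 = X.inner f f := by
  rw [norm₂, inner_eq_toEuclidean, real_inner_self_eq_norm_sq]

theorem norm₂_eq_sqrt (f : (∀ i, Ω i) → ℝ) : X.norm₂ f = √(X.inner f f) := by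
  rw [← norm₂_sq, Real.sqrt_sq (X.norm₂_nonneg f)]

theorem abs_inner_le (f g : (∀ i, Ω i) → ℝ) : |X.inner f g| ≤ X.norm₂ f * X.norm₂ g := by
  rw [inner_eq_toEuclidean]
  exact abs_real_inner_le_norm _ _

theorem norm₂_add_le (f g : (∀ i, Ω i) → ℝ) : X.norm₂ (f + g) ≤ X.norm₂ f + X.norm₂ g := by
  simpa [norm₂] using norm_add_le (X.toEuclidean f) (X.toEuclidean g)

theorem norm₂_smul (c : ℝ) (f : (∀ i, Ω i) → ℝ) : X.norm₂ (c • f) = |c| * X.norm₂ f := by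
  simp [norm₂, norm_smul]

theorem norm₂_sum_le {κ : Type*} (s : Finset κ) (f : κ → (∀ i, Ω i) → ℝ) :
    X.norm₂ (∑ k ∈ s, f k) ≤ ∑ k ∈ s, X.norm₂ (f k) := by
  simpa [norm₂] using norm_sum_le s fun k => X.toEuclidean (f k)

theorem norm₂_congr {f g : (∀ i, Ω i) → ℝ} (h : ∀ x, X.IsFace x → f x = g x) :
    X.norm₂ f = X.norm₂ g := by
  rw [norm₂_eq_sqrt, norm₂_eq_sqrt, X.inner_congr h h]

theorem norm₂_le_of_abs_le {f : (∀ i, Ω i) → ℝ} {B : ℝ} (hB : 0 ≤ B)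
    (h : ∀ x, X.IsFace x → |f x| ≤ B) : X.norm₂ f ≤ B := by
  refine le_of_sq_le_sq ?_ hB
  rw [norm₂_sq, ← X.expect_const (B ^ 2)]
  exact X.expect_mono fun x hx => by rw [← sq]; exact sq_le_sq' (abs_le.1 (h x hx)).1 (abs_le.1 (h x hx)).2

theorem norm₂_le_of_inner_le {f : (∀ i, Ω i) → ℝ} {C : ℝ} (h : X.inner f f ≤ C * X.norm₂ f)
    (hC : 0 ≤ C) : X.norm₂ f ≤ C := by
  rcases (X.norm₂_nonneg f).eq_or_lt with h0 | h0
  · rwa [← h0]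
  · rw [← norm₂_sq, sq] at h
    exact le_of_mul_le_mul_right h h0

/-! ### Conditional averages as orthogonal projections -/

theorem dependsOn_average (T : Finset (Fin d)) (f : (∀ i, Ω i) → ℝ) :
    DependsOn (X.average T f) T := fun x y h => by
  rw [average, average, cylinder_congr h]

/-- The averaging operator `E_T` as a linear map. -/
def averageLM (T : Finset (Fin d)) : ((∀ i, Ω i) → ℝ) →ₗ[ℝ] ((∀ i, Ω i) → ℝ) where
  toFun := X.average T
  map_add' f g := by
    ext y
    simp only [average, condExpect, Pi.add_apply, ← add_div, ← sum_add_distrib]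
    congr 1
    refine sum_congr rfl fun x _ => ?_
    split_ifs <;> ring
  map_smul' c f := by
    ext y
    simp only [average, condExpect, Pi.smul_apply, smul_eq_mul, RingHom.id_apply, ← mul_div_assoc,
      mul_sum]
    congr 1
    refine sum_congr rfl fun x _ => ?_
    split_ifs <;> ring

theorem averageLM_apply (T : Finset (Fin d)) (f : (∀ i, Ω i) → ℝ) :
    X.averageLM T f = X.average T f := rfl

theorem average_sub (T : Finset (Fin d)) (f g : (∀ i, Ω i) → ℝ) :
    X.average T (f - g) = X.average T f - X.average T g := (X.averageLM T).map_sub f g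

theorem average_eq_of_dependsOn {T : Finset (Fin d)} {f : (∀ i, Ω i) → ℝ} (hf : DependsOn f T)
    {y : ∀ i, Ω i} (hy : X.IsFace y) : X.average T f y = f y := by
  have h := (X.prob_cylinder_pos T y hy).ne'
  rw [average, condExpect, div_eq_iff h, prob, mul_sum]
  refine sum_congr rfl fun x _ => ?_
  split_ifs with hx
  · rw [hf fun i hi => hx i hi, mul_comm]
  · simp

theorem inner_average_of_dependsOn {T : Finset (Fin d)} {h : (∀ i, Ω i) → ℝ} (hh : DependsOn h T)
    (f : (∀ i, Ω i) → ℝ) : X.inner h (X.average T f) = X.inner h f := by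
  classical
  have e : ∀ y, X.weight y * (h y * X.average T f y)
      = ∑ x, if y ∈ cylinder T x then
          X.weight y * (h x * (X.weight x * f x) / X.prob (cylinder T x)) else 0 := by
    intro y
    rw [average, condExpect, ← mul_div_assoc, ← mul_div_assoc, mul_sum, mul_sum, sum_div]
    refine sum_congr rfl fun x _ => ?_
    by_cases hx : y ∈ cylinder T x
    · rw [if_pos hx, if_pos (mem_cylinder_comm.1 hx),
        cylinder_congr (T := T) (x := y) (y := x) fun i hi => hx i hi, hh fun i hi => hx i hi]
      ring
    · rw [if_neg hx, if_neg fun hc => hx (mem_cylinder_comm.1 hc)]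
      simp
  rw [inner, expect, sum_congr rfl fun y _ => e y, sum_comm]
  refine sum_congr rfl fun x _ => ?_
  rw [← sum_filter, ← sum_mul, sum_filter]
  rcases (X.weight_nonneg x).eq_or_lt with hx | hx
  · simp [← hx]
  · have hp := (X.prob_cylinder_pos T x hx).ne'
    have hp' : (∑ y, if y ∈ cylinder T x then X.weight y else 0) = X.prob (cylinder T x) := by
      rw [prob]
    rw [hp']
    field_simp

theorem inner_average_left (T : Finset (Fin d)) (f g : (∀ i, Ω i) → ℝ) :
    X.inner (X.average T f) g = X.inner f (X.average T g) := by
  rw [← X.inner_average_of_dependsOn (X.dependsOn_average T f), X.inner_comm f,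
    ← X.inner_average_of_dependsOn (X.dependsOn_average T g), X.inner_comm]

theorem inner_average_average (T : Finset (Fin d)) (f g : (∀ i, Ω i) → ℝ) :
    X.inner (X.average T f) (X.average T g) = X.inner (X.average T f) g :=
  X.inner_average_of_dependsOn (X.dependsOn_average T f) g

theorem norm₂_average_le (T : Finset (Fin d)) (f : (∀ i, Ω i) → ℝ) :
    X.norm₂ (X.average T f) ≤ X.norm₂ f := by
  refine X.norm₂_le_of_inner_le ?_ (X.norm₂_nonneg f)
  rw [inner_average_average, mul_comm]
  exact (le_abs_self _).trans (X.abs_inner_le _ _)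

theorem eq_zero_of_inner_self_eq_zero {f : (∀ i, Ω i) → ℝ} (h : X.inner f f = 0) {x : ∀ i, Ω i}
    (hx : X.IsFace x) : f x = 0 := by
  have h0 := (sum_eq_zero_iff_of_nonneg fun x _ =>
    mul_nonneg (X.weight_nonneg x) (mul_self_nonneg (f x))).1 h x (mem_univ x)
  rcases mul_eq_zero.1 h0 with h1 | h1
  · exact absurd h1 hx.ne'
  · exact mul_self_eq_zero.1 h1

/-- The tower property. -/
theorem average_average_of_subset {T U : Finset (Fin d)} (hTU : T ⊆ U) (f : (∀ i, Ω i) → ℝ)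
    {x : ∀ i, Ω i} (hx : X.IsFace x) : X.average T (X.average U f) x = X.average T f x := by
  have hd : ∀ g, DependsOn (X.average T g) U := fun g _ _ h =>
    X.dependsOn_average T g fun i hi => h i (hTU hi)
  refine sub_eq_zero.1 (X.eq_zero_of_inner_self_eq_zero
    (f := X.average T (X.average U f) - X.average T f) ?_ hx)
  rw [← average_sub, inner_average_average, inner_sub_right,
    X.inner_average_of_dependsOn (hd _), sub_self]

theorem abs_average_le {T : Finset (Fin d)} {f : (∀ i, Ω i) → ℝ} {B : ℝ} (hB : 0 ≤ B)
    (h : ∀ x, X.IsFace x → |f x| ≤ B) (y : ∀ i, Ω i) : |X.average T f y| ≤ B := by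
  have hp : 0 ≤ X.prob (cylinder T y) :=
    sum_nonneg fun x _ => by split_ifs <;> [exact X.weight_nonneg x; exact le_rfl]
  rw [average, condExpect, abs_div, abs_of_nonneg hp]
  refine div_le_of_le_mul₀ hp hB ((abs_sum_le_sum_abs _ _).trans ?_)
  rw [prob, mul_sum]
  refine sum_le_sum fun x _ => ?_
  split_ifs
  · rw [abs_mul, abs_of_nonneg (X.weight_nonneg x), mul_comm]
    rcases (X.weight_nonneg x).eq_or_lt with hx | hx
    · simp [← hx]
    · exact mul_le_mul_of_nonneg_right (h x hx) hx.le
  · simp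

theorem expect_average (T : Finset (Fin d)) (f : (∀ i, Ω i) → ℝ) :
    X.expect (X.average T f) = X.expect f := by
  have h := X.inner_average_of_dependsOn (T := T) (h := fun _ => 1) (fun _ _ _ => rfl) f
  simpa [inner] using h

/-! ### Links, and from spectral gaps to covariances -/

theorem expect_link (T : Finset (Fin d)) {y : ∀ i, Ω i} (hy : X.IsFace y)
    (f : (∀ i, Ω i) → ℝ) : (X.link T y hy).expect f = X.average T f y := by
  rw [average, condExpect, sum_div]
  refine sum_congr rfl fun x _ => ?_
  simp only [link]
  split_ifs <;> ring

theorem isFace_link {T : Finset (Fin d)} {y x : ∀ i, Ω i} {hy : X.IsFace y}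
    (hx : (X.link T y hy).IsFace x) : x ∈ cylinder T y := by
  by_contra h
  simp [IsFace, link, h] at hx

theorem colourNorm_eq_norm₂ (i : Fin d) (g : Ω i → ℝ) :
    X.colourNorm i g = X.norm₂ fun x => g (x i) := by
  rw [norm₂_eq_sqrt, colourNorm]
  simp only [inner, sq]

theorem walk_apply (i j : Fin d) (g : Ω i → ℝ) (x : ∀ i, Ω i) :
    X.walk i j g (x j) = X.average {j} (fun z => g (z i)) x := by
  have : cylinder {j} x = {z : ∀ i, Ω i | z j = x j} := by ext z; simp [cylinder]
  rw [walk, average, this]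

theorem abs_expect_le_norm₂ (f : (∀ i, Ω i) → ℝ) : |X.expect f| ≤ X.norm₂ f := by
  have h := X.abs_inner_le f fun _ => 1
  have h1 : X.norm₂ (fun _ => 1) ≤ 1 := X.norm₂_le_of_abs_le zero_le_one fun x _ => by simp
  rw [inner] at h
  simp only [mul_one] at h
  exact h.trans (mul_le_of_le_one_right (X.norm₂_nonneg f) h1)

/-- This crude bound makes the set of admissible constants in `lambda₂` nonempty. Otherwise its
infimum could be the default value `0`, and a bound on `lambda₂` would say nothing. -/
theorem colourNorm_walk_sub_stationary_le_two_mul (i j : Fin d) (g : Ω i → ℝ) :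
    X.colourNorm j (X.walk i j g - X.stationary i j g) ≤ 2 * X.colourNorm i g := by
  rw [colourNorm_eq_norm₂, colourNorm_eq_norm₂]
  set G : (∀ i, Ω i) → ℝ := fun x => g (x i)
  have e : (fun x : ∀ i, Ω i => (X.walk i j g - X.stationary i j g) (x j))
      = X.average {j} G + (-1 : ℝ) • fun _ => X.expect G := by
    ext x
    simp only [Pi.sub_apply, Pi.add_apply, Pi.smul_apply, walk_apply, stationary, smul_eq_mul]
    ring
  rw [e]
  refine (X.norm₂_add_le _ _).trans ?_
  rw [norm₂_smul, abs_neg, abs_one, one_mul, two_mul]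
  exact add_le_add (X.norm₂_average_le _ _)
    (X.norm₂_le_of_abs_le (X.norm₂_nonneg G) fun _ _ => X.abs_expect_le_norm₂ G)

theorem colourNorm_walk_sub_stationary_le {γ : ℝ} {i j : Fin d} (h : X.lambda₂ i j ≤ γ)
    (g : Ω i → ℝ) :
    X.colourNorm j (X.walk i j g - X.stationary i j g) ≤ γ * X.colourNorm i g := by
  have hn : 0 ≤ X.colourNorm i g := Real.sqrt_nonneg _
  refine le_of_forall_pos_le_add fun η hη => ?_
  have hpos : 0 < η / (X.colourNorm i g + 1) := by positivity
  obtain ⟨c, hc, hlt⟩ := exists_lt_of_csInf_lt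
    (by exact ⟨2, zero_le_two, X.colourNorm_walk_sub_stationary_le_two_mul i j⟩)
    (lt_of_le_of_lt h (lt_add_of_pos_right γ hpos))
  refine (hc.2 g).trans ((mul_le_mul_of_nonneg_right hlt.le hn).trans ?_)
  rw [add_mul]
  gcongr
  rw [div_mul_eq_mul_div, div_le_iff₀ (by positivity)]
  nlinarith

theorem abs_covariance_le {γ : ℝ} {i j : Fin d} (h : X.lambda₂ i j ≤ γ) (F : Ω j → ℝ)
    (G : Ω i → ℝ) :
    |X.inner (fun x => F (x j)) (fun x => G (x i))
      - X.expect (fun x => F (x j)) * X.expect (fun x => G (x i))|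
      ≤ γ * (X.norm₂ (fun x => F (x j)) * X.norm₂ fun x => G (x i)) := by
  have hdep : DependsOn (fun x : ∀ i, Ω i => F (x j)) (({j} : Finset (Fin d)) : Set (Fin d)) :=
    fun x y hxy => congrArg F (hxy j (by simp))
  have e : X.inner (fun x => F (x j)) (fun x => G (x i))
      - X.expect (fun x => F (x j)) * X.expect (fun x => G (x i))
      = X.inner (fun x => F (x j)) fun x => (X.walk i j G - X.stationary i j G) (x j) := by
    rw [← X.inner_average_of_dependsOn hdep, mul_comm, ← expect_const_mul, inner, inner,
      ← expect_sub]
    congr 1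
    ext x
    simp only [Pi.sub_apply, walk_apply, stationary]
    ring
  rw [e]
  have h1 := X.colourNorm_walk_sub_stationary_le h G
  rw [colourNorm_eq_norm₂, colourNorm_eq_norm₂] at h1
  refine (X.abs_inner_le _ _).trans ((mul_le_mul_of_nonneg_left h1 (X.norm₂_nonneg _)).trans ?_)
  apply le_of_eq
  ring

/-- Lets bounds by conditional `L²` norms be integrated over the conditioning with Cauchy–Schwarz.
-/
theorem norm₂_sqrt_average_sq (T : Finset (Fin d)) (f : (∀ i, Ω i) → ℝ) :
    X.norm₂ (fun y => √(X.average T (fun x => f x * f x) y)) = X.norm₂ f := by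
  rw [norm₂_eq_sqrt, norm₂_eq_sqrt]
  congr 1
  rw [inner, inner, ← X.expect_average T fun x => f x * f x]
  refine X.expect_congr fun y hy => Real.mul_self_sqrt ?_
  rw [← X.expect_link T hy]
  exact expect_nonneg _ fun x _ => mul_self_nonneg _

/-! ### Approximate independence of disjoint blocks of coordinates -/

/-- Conditionally on the coordinates in `U`, a function of the coordinates in `T` and a function of
the coordinates in `S` are correlated by at most `κ`. -/
def CovarianceBound (κ : ℝ) (S T : Finset (Fin d)) : Prop :=
  ∀ (U : Finset (Fin d)), Disjoint S U → Disjoint T U → ∀ f g : (∀ i, Ω i) → ℝ,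
    DependsOn f (↑(T ∪ U) : Set (Fin d)) → DependsOn g (↑(S ∪ U) : Set (Fin d)) →
    |X.inner f g - X.inner (X.average U f) (X.average U g)| ≤ κ * (X.norm₂ f * X.norm₂ g)

variable {X}

theorem CovarianceBound.symm {κ : ℝ} {S T : Finset (Fin d)} (h : X.CovarianceBound κ S T) :
    X.CovarianceBound κ T S := fun U hT hS f g hf hg => by
  rw [X.inner_comm, X.inner_comm (X.average U f), mul_comm (X.norm₂ f)]
  exact h U hS hT g f hg hf

/-- In the link of `y_U`, `f` is a function of `x_j` alone and `g` of `x_i` alone, so the spectral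
gap bounds their conditional covariance. Averaging over `y` and Cauchy–Schwarz conclude. -/
theorem IsGammaProduct.covarianceBound_singleton {γ : ℝ} (hX : X.IsGammaProduct γ)
    (hγ : 0 ≤ γ) {i j : Fin d} (hij : i ≠ j) : X.CovarianceBound γ {i} {j} := by
  intro U hi hj f g hf hg
  rw [disjoint_singleton_left] at hi hj
  have key : ∀ y, X.IsFace y →
      |X.average U (fun x => f x * g x) y - X.average U f y * X.average U g y|
        ≤ γ * (√(X.average U (fun x => f x * f x) y) * √(X.average U (fun x => g x * g x) y)) := by
    intro y hy
    have hF : ∀ x, (X.link U y hy).IsFace x → f x = f (Function.update y j (x j)) := by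
      refine fun x hx => hf fun k hk => ?_
      by_cases hkj : k = j
      · subst hkj; simp
      · rw [Function.update_of_ne hkj]
        exact X.isFace_link hx k (by simpa [hkj] using hk)
    have hG : ∀ x, (X.link U y hy).IsFace x → g x = g (Function.update y i (x i)) := by
      refine fun x hx => hg fun k hk => ?_
      by_cases hki : k = i
      · subst hki; simp
      · rw [Function.update_of_ne hki]
        exact X.isFace_link hx k (by simpa [hki] using hk)
    have h := (X.link U y hy).abs_covariance_le (hX U y hy i j hi hj hij)
      (fun b => f (Function.update y j b)) (fun a => g (Function.update y i a))
    rw [← inner_congr _ hF hG, ← expect_congr _ hF, ← expect_congr _ hG, ← norm₂_congr _ hF,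
      ← norm₂_congr _ hG, norm₂_eq_sqrt, norm₂_eq_sqrt, inner, inner, inner] at h
    simpa only [expect_link] using h
  have e : X.inner f g - X.inner (X.average U f) (X.average U g)
      = X.expect fun y => X.average U (fun x => f x * g x) y - X.average U f y * X.average U g y := by
    rw [expect_sub, expect_average, inner, inner]
  rw [e]
  calc _ ≤ X.expect fun y =>
        γ * (√(X.average U (fun x => f x * f x) y) * √(X.average U (fun x => g x * g x) y)) := by
        rw [abs_le, ← neg_one_mul, ← expect_const_mul]
        exact ⟨X.expect_mono fun y hy => by have := (abs_le.1 (key y hy)).1; linarith,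
          X.expect_mono fun y hy => (abs_le.1 (key y hy)).2⟩
    _ ≤ γ * (X.norm₂ f * X.norm₂ g) := by
        rw [expect_const_mul]
        refine mul_le_mul_of_nonneg_left ?_ hγ
        rw [← X.norm₂_sqrt_average_sq U f, ← X.norm₂_sqrt_average_sq U g]
        exact (le_abs_self _).trans (X.abs_inner_le _ _)

/-- Telescoping: coordinates of `T` are moved one at a time into the conditioning. Conditioning
first on `U ∪ {j}` and then on `U` costs one `κ` for `j`. -/
theorem covarianceBound_of_forall_singleton {κ : ℝ} (hκ : 0 ≤ κ) {S T : Finset (Fin d)}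
    (hST : Disjoint S T) (h : ∀ j ∈ T, X.CovarianceBound κ S {j}) :
    X.CovarianceBound (T.card * κ) S T := by
  induction T using Finset.induction_on with
  | empty =>
    intro U _ _ f g hf hg
    rw [empty_union] at hf
    have : X.inner f g = X.inner (X.average U f) (X.average U g) := by
      rw [← X.inner_average_of_dependsOn hf g]
      exact X.inner_congr (fun x hx => (X.average_eq_of_dependsOn hf hx).symm) fun _ _ => rfl
    simp [this]
  | insert j T hj ih =>
    intro U hSU hTU f g hf hg
    rw [disjoint_insert_left] at hTU
    rw [disjoint_insert_right] at hST
    have h1 := ih hST.2 (fun k hk => h k (mem_insert_of_mem hk)) (insert j U)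
      (by rw [disjoint_insert_right]; exact ⟨hST.1, hSU⟩)
      (by rw [disjoint_insert_right]; exact ⟨hj, hTU.2⟩) f g
      (by rwa [union_insert, ← insert_union])
      (fun x y hxy => hg fun k hk => hxy k (by
        simp only [coe_union, Set.mem_union, mem_coe, mem_insert] at hk ⊢; tauto))
    have h2 := h j (mem_insert_self j T) U hSU (disjoint_singleton_left.2 hTU.1)
      (X.average (insert j U) f) g (X.dependsOn_average _ f) hg
    have h3 : X.inner (X.average U (X.average (insert j U) f)) (X.average U g)
        = X.inner (X.average U f) (X.average U g) :=
      X.inner_congr (fun x hx => X.average_average_of_subset (subset_insert j U) f hx) fun _ _ => rfl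
    rw [inner_average_average] at h1
    rw [h3] at h2
    have h4 : X.norm₂ (X.average (insert j U) f) * X.norm₂ g ≤ X.norm₂ f * X.norm₂ g :=
      mul_le_mul_of_nonneg_right (X.norm₂_average_le _ f) (X.norm₂_nonneg g)
    have h5 := mul_le_mul_of_nonneg_left h4 hκ
    rw [card_insert_of_notMem hj]
    push_cast
    rw [abs_le] at h1 h2 ⊢
    constructor <;> linarith [h1.1, h1.2, h2.1, h2.2]

variable (X) in
/-- The averaging operators commute and intersect up to an error `κ` in `L²`. -/
def ApproxIndependent (κ : ℝ) : Prop :=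
  ∀ (T T' : Finset (Fin d)) (u v : (∀ i, Ω i) → ℝ),
    |X.inner (X.average T u) (X.average T' v) - X.inner (X.average (T ∩ T') u) v|
      ≤ κ * (X.norm₂ u * X.norm₂ v)

/-- Condition on `T ∩ T'`: what remains are functions of the disjoint blocks `T \ T'` and `T' \ T`.
Telescoping over both blocks costs at most `d²` single-coordinate errors. -/
theorem IsGammaProduct.approxIndependent {γ : ℝ} (hX : X.IsGammaProduct γ) (hγ : 0 ≤ γ) :
    X.ApproxIndependent ((d : ℝ) ^ 2 * γ) := by
  intro T T' u v
  have hdisj : Disjoint (T' \ T) (T \ T') := disjoint_sdiff_sdiff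
  have h1 : ∀ j ∈ T \ T', X.CovarianceBound ((T' \ T).card * γ) (T' \ T) {j} := fun j hj =>
    (covarianceBound_of_forall_singleton hγ
      (disjoint_singleton_left.2 fun hc => disjoint_left.1 hdisj hc hj) fun i hi =>
        hX.covarianceBound_singleton hγ fun hc => disjoint_left.1 hdisj hi (hc ▸ hj)).symm
  have h2 := covarianceBound_of_forall_singleton (by positivity) hdisj h1 (T ∩ T')
    (disjoint_left.2 fun k hk hk' => by simp at hk hk'; tauto)
    (disjoint_left.2 fun k hk hk' => by simp at hk hk'; tauto)
    (X.average T u) (X.average T' v)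
    (by rw [sdiff_union_inter]; exact X.dependsOn_average T u)
    (by rw [inter_comm, sdiff_union_inter]; exact X.dependsOn_average T' v)
  have h3 : X.inner (X.average (T ∩ T') (X.average T u)) (X.average (T ∩ T') (X.average T' v))
      = X.inner (X.average (T ∩ T') u) v := by
    rw [← X.inner_average_average (T ∩ T') u v]
    exact X.inner_congr (fun x hx => X.average_average_of_subset inter_subset_left u hx)
      fun x hx => X.average_average_of_subset inter_subset_right v hx
  rw [h3] at h2
  refine h2.trans (mul_le_mul ?_ (mul_le_mul (X.norm₂_average_le _ _) (X.norm₂_average_le _ _)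
    (X.norm₂_nonneg _) (X.norm₂_nonneg _)) (mul_nonneg (X.norm₂_nonneg _) (X.norm₂_nonneg _))
    (by positivity))
  have hc : ∀ S : Finset (Fin d), (S.card : ℝ) ≤ d := fun S => by
    exact_mod_cast (card_le_univ S).trans_eq (Fintype.card_fin d)
  rw [← mul_assoc, sq]
  exact mul_le_mul_of_nonneg_right (mul_le_mul (hc _) (hc _) (by positivity) (by positivity)) hγ

variable (X)

/-! ### Efron–Stein components and their approximate orthogonality -/

theorem efronStein_eq_moebius (S : Finset (Fin d)) (f : (∀ i, Ω i) → ℝ) :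
    X.efronStein S f = moebius (fun T => X.average T f) S := by
  ext x
  simp [efronStein, moebius]

/-- The map `f ↦ f^{=S}` as a linear map. -/
def efronSteinLM (S : Finset (Fin d)) : ((∀ i, Ω i) → ℝ) →ₗ[ℝ] ((∀ i, Ω i) → ℝ) :=
  moebius X.averageLM S

theorem efronSteinLM_apply (S : Finset (Fin d)) (f : (∀ i, Ω i) → ℝ) :
    X.efronSteinLM S f = X.efronStein S f := by
  rw [efronStein_eq_moebius, efronSteinLM]
  simp [moebius, averageLM_apply]

theorem inner_efronStein_left (S : Finset (Fin d)) (f g : (∀ i, Ω i) → ℝ) :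
    X.inner (X.efronStein S f) g = moebius (fun T => X.inner (X.average T f) g) S := by
  rw [efronStein_eq_moebius]
  exact map_moebius (X.innerLM g) _ S

theorem inner_efronStein_comm (S : Finset (Fin d)) (f g : (∀ i, Ω i) → ℝ) :
    X.inner (X.efronStein S f) g = X.inner f (X.efronStein S g) := by
  rw [X.inner_comm f, inner_efronStein_left, inner_efronStein_left]
  exact moebius_congr fun T _ => by rw [inner_average_left, X.inner_comm]

theorem sum_inner_efronStein (T : Finset (Fin d)) (f : (∀ i, Ω i) → ℝ) :
    ∑ S ∈ T.powerset, X.inner (X.efronStein S f) f = X.inner (X.average T f) f := by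
  simp only [inner_efronStein_left]
  exact sum_moebius _ T

theorem average_univ {f : (∀ i, Ω i) → ℝ} {x : ∀ i, Ω i} (hx : X.IsFace x) :
    X.average univ f x = f x :=
  X.average_eq_of_dependsOn (fun y z h => by rw [funext fun i => h i (by simp)]) hx

theorem average_empty (f : (∀ i, Ω i) → ℝ) (x : ∀ i, Ω i) : X.average ∅ f x = X.expect f := by
  have : cylinder ∅ x = (Set.univ : Set (∀ i, Ω i)) := by ext; simp [cylinder]
  rw [average, this, condExpect, prob]
  simp [X.sum_weight, expect]

theorem two_pow_card_le (S : Finset (Fin d)) : (2 : ℝ) ^ S.card ≤ 2 ^ d :=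
  pow_le_pow_right₀ one_le_two ((card_le_univ S).trans_eq (Fintype.card_fin d))

theorem norm₂_moebius_le {F : Finset (Fin d) → (∀ i, Ω i) → ℝ} {S : Finset (Fin d)} {B : ℝ}
    (h : ∀ T ⊆ S, X.norm₂ (F T) ≤ B) : X.norm₂ (moebius F S) ≤ 2 ^ S.card * B := by
  refine (X.norm₂_sum_le _ _).trans ((sum_le_card_nsmul _ _ B fun T hT => ?_).trans ?_)
  · simpa [norm₂_smul] using h T (mem_powerset.1 hT)
  · simp [card_powerset]

theorem abs_efronStein_le {f : (∀ i, Ω i) → ℝ} {B : ℝ} (hB : 0 ≤ B)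
    (h : ∀ x, X.IsFace x → |f x| ≤ B) (S : Finset (Fin d)) (x : ∀ i, Ω i) :
    |X.efronStein S f x| ≤ 2 ^ d * B := by
  rw [efronStein_eq_moebius, moebius_apply]
  exact (abs_moebius_le fun T _ => X.abs_average_le hB h x).trans
    (mul_le_mul_of_nonneg_right (two_pow_card_le S) hB)

/-- Approximate independence is tested against the difference itself. -/
theorem norm₂_average_average_sub_le {κ : ℝ} (h : X.ApproxIndependent κ) (hκ : 0 ≤ κ)
    (T T' : Finset (Fin d)) (u : (∀ i, Ω i) → ℝ) :
    X.norm₂ (X.average T' (X.average T u) - X.average (T ∩ T') u) ≤ κ * X.norm₂ u := by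
  set v := X.average T' (X.average T u) - X.average (T ∩ T') u
  refine X.norm₂_le_of_inner_le ?_ (mul_nonneg hκ (X.norm₂_nonneg u))
  have := h T T' u v
  rw [← inner_average_left, ← inner_sub_left] at this
  rw [mul_assoc]
  exact (le_abs_self _).trans this

/-- Replacing `⟨E_T f, E_T' f⟩` by `⟨E_{T ∩ T'} f, f⟩` makes the double Möbius sum diagonal, at a
cost of `κ` for each of at most `4^d` pairs. -/
theorem norm₂_efronStein_sq_le {κ : ℝ} (h : X.ApproxIndependent κ) (hκ : 0 ≤ κ)
    (S : Finset (Fin d)) (f : (∀ i, Ω i) → ℝ) :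
    X.inner (X.efronStein S f) (X.efronStein S f)
      ≤ X.inner (X.efronStein S f) f + 4 ^ d * κ * X.norm₂ f ^ 2 := by
  set q : Finset (Fin d) → ℝ := fun T => X.inner (X.average T f) f
  have e1 : X.inner (X.efronStein S f) (X.efronStein S f)
      = moebius (fun T => moebius (fun T' => X.inner (X.average T f) (X.average T' f)) S) S := by
    rw [inner_efronStein_left]
    refine moebius_congr fun T _ => ?_
    rw [X.inner_comm, inner_efronStein_left]
    exact moebius_congr fun T' _ => X.inner_comm _ _
  have e2 : X.inner (X.efronStein S f) f = moebius (fun T => moebius (fun T' => q (T ∩ T')) S) S := by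
    rw [moebius_moebius_inter, inner_efronStein_left]
  have hn : 0 ≤ κ * (X.norm₂ f * X.norm₂ f) :=
    mul_nonneg hκ (mul_nonneg (X.norm₂_nonneg f) (X.norm₂_nonneg f))
  rw [← sub_le_iff_le_add', e1, e2, ← moebius_sub]
  refine (le_abs_self _).trans ((abs_moebius_le (B := 2 ^ d * (κ * (X.norm₂ f * X.norm₂ f)))
    fun T _ => ?_).trans ?_)
  · rw [← moebius_sub]
    exact (abs_moebius_le fun T' _ => h T T' f f).trans
      (mul_le_mul_of_nonneg_right (two_pow_card_le S) hn)
  · refine (mul_le_mul_of_nonneg_right (two_pow_card_le S) (by positivity)).trans_eq ?_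
    rw [show (4 : ℝ) = 2 * 2 by norm_num, mul_pow]
    ring

theorem sum_inner_efronStein_filter (i : Fin d) (f : (∀ i, Ω i) → ℝ) :
    ∑ S : Finset (Fin d), (if i ∈ S then X.inner (X.efronStein S f) f else 0)
      = X.inner f (X.laplacian i f) := by
  have h1 := X.sum_inner_efronStein univ f
  have h2 := X.sum_inner_efronStein (univ.erase i) f
  have h3 : X.inner (X.average univ f) f = X.inner f f :=
    X.inner_congr (fun x hx => X.average_univ hx) fun _ _ => rfl
  have h4 : X.laplacian i f = f - X.average (univ.erase i) f := rfl
  rw [h4, inner_sub_right, ← inner_average_left, ← h2, ← h3, ← h1, powerset_univ,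
    ← sum_filter,
    ← sum_filter_add_sum_filter_not univ (fun S => i ∈ S) fun S => X.inner (X.efronStein S f) f]
  have : (univ.erase i).powerset = univ.filter fun S : Finset (Fin d) => i ∉ S := by
    ext S
    simp [subset_erase]
  rw [this]
  ring

/-- Exact, since Möbius inversion needs no independence. The price is that `⟨f^{=S}, f⟩` need not be
a square and may be slightly negative. -/
theorem totalInfluence_eq_sum (f : (∀ i, Ω i) → ℝ) :
    X.totalInfluence f = ∑ S : Finset (Fin d), S.card * X.inner (X.efronStein S f) f := by
  simp only [totalInfluence, ← sum_inner_efronStein_filter]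
  rw [sum_comm]
  refine sum_congr rfl fun S _ => ?_
  simp

theorem variance_eq_sum (f : (∀ i, Ω i) → ℝ) :
    X.variance f = ∑ S ∈ (univ : Finset (Finset (Fin d))).erase ∅,
      X.inner (X.efronStein S f) f := by
  have h1 := X.sum_inner_efronStein univ f
  have h2 := X.sum_inner_efronStein ∅ f
  have h3 : X.inner (X.average univ f) f = X.inner f f :=
    X.inner_congr (fun x hx => X.average_univ hx) fun _ _ => rfl
  have h4 : X.inner (X.average ∅ f) f = X.expect f ^ 2 := by
    rw [inner, sq, ← expect_const_mul]
    simp only [average_empty]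
  rw [powerset_univ, h3, ← add_sum_erase univ _ (mem_univ (∅ : Finset (Fin d)))] at h1
  rw [powerset_empty, sum_singleton, h4] at h2
  rw [h2] at h1
  rw [variance, ← add_right_inj (X.expect f ^ 2), h1]
  have : (fun x => (f x - X.expect f) ^ 2)
      = fun x => (f x * f x - (2 * X.expect f) * f x) + X.expect f ^ 2 := by ext x; ring
  rw [this, expect_add, expect_sub, expect_const_mul, expect_const, inner]
  ring

/-! ### Multipliers are almost bounded on `L⁴` -/

/-- The correction in `a³h` integrates to zero when `a` is a conditional average and `h` the
remainder. The rest of the difference is `h²` times a quadratic form in `a, h`, positive for small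
`b`. -/
theorem quartic_le {a h b : ℝ} (hb : |b| ≤ 1 / 4) :
    (a + b * h) ^ 4 ≤ (a + h) ^ 4 + 4 * (b - 1) * (a ^ 3 * h) := by
  obtain ⟨hb1, hb2⟩ := abs_le.1 hb
  have h2 : b ^ 2 ≤ 1 / 16 := by nlinarith
  have h3 : |b ^ 3| ≤ 1 / 64 := by
    rw [abs_pow]
    exact (pow_le_pow_left₀ (abs_nonneg b) hb 3).trans_eq (by norm_num)
  obtain ⟨h31, h32⟩ := abs_le.1 h3
  have h4 : b ^ 4 ≤ 1 / 256 := by nlinarith [sq_nonneg b]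
  have key : 0 ≤ 6 * (1 - b ^ 2) * a ^ 2 + 4 * (1 - b ^ 3) * (a * h) + (1 - b ^ 4) * h ^ 2 := by
    have k1 : 0 ≤ (1 - b ^ 3) * (4 / 5 * (h + 5 / 2 * a) ^ 2) := by
      apply mul_nonneg
      · linarith
      · positivity
    have k2 : 0 ≤ (6 * (1 - b ^ 2) - 5 * (1 - b ^ 3)) * a ^ 2 :=
      mul_nonneg (by linarith) (sq_nonneg a)
    have k3 : 0 ≤ ((1 - b ^ 4) - 4 / 5 * (1 - b ^ 3)) * h ^ 2 :=
      mul_nonneg (by linarith) (sq_nonneg h)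
    linear_combination k1 + k2 + k3
  linear_combination mul_nonneg (sq_nonneg h) key

/-- Shrinking the part of `v` that averages to zero does not increase its `L⁴` norm. -/
theorem expect_pow_four_le (T : Finset (Fin d)) (v : (∀ i, Ω i) → ℝ) {b : ℝ} (hb : |b| ≤ 1 / 4) :
    X.expect (fun x => (X.average T v x + b * (v x - X.average T v x)) ^ 4)
      ≤ X.expect fun x => v x ^ 4 := by
  have hz : X.expect (fun x => X.average T v x ^ 3 * (v x - X.average T v x)) = 0 := by
    have hd : DependsOn (fun x => X.average T v x ^ 3) T := fun x y hxy =>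
      congrArg (· ^ 3) (X.dependsOn_average T v hxy)
    have h := X.inner_average_of_dependsOn hd v
    rw [inner, inner] at h
    simp only [mul_sub, expect_sub, h, sub_self]
  calc _ ≤ X.expect fun x => v x ^ 4
        + 4 * (b - 1) * (X.average T v x ^ 3 * (v x - X.average T v x)) := by
        refine X.expect_mono fun x _ => (quartic_le hb).trans_eq ?_
        rw [add_sub_cancel]
    _ = _ := by rw [expect_add, expect_const_mul, hz]; ring

/-- The multiplier `∑_S (∏_{i ∈ S} b_i) u^{=S}`. -/
def multiplier (b : Fin d → ℝ) (u : (∀ i, Ω i) → ℝ) : (∀ i, Ω i) → ℝ :=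
  ∑ S : Finset (Fin d), (∏ i ∈ S, b i) • X.efronStein S u

theorem abs_prod_le_one {b : Fin d → ℝ} (hb : ∀ i, |b i| ≤ 1 / 4) (S : Finset (Fin d)) :
    |∏ i ∈ S, b i| ≤ 1 := by
  rw [abs_prod]
  exact prod_le_one (fun _ _ => abs_nonneg _) fun i _ => (hb i).trans (by norm_num)

/-- The function `v` is obtained by applying `E + b_a (1 - E)`, `E = E_{[d] ∖ {a}}`, for each `a ∈
V` in turn. Each step contracts `L⁴`, and `E E_T ≈ E_{T ∖ {a}}` keeps `v` close in `L²` to the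
partial multiplier, in which the coordinates outside `V` are still untouched. -/
theorem exists_contraction_near_multiplier {κ : ℝ} (h : X.ApproxIndependent κ) (hκ : 0 ≤ κ)
    {b : Fin d → ℝ} (hb : ∀ i, |b i| ≤ 1 / 4) {u : (∀ i, Ω i) → ℝ} {B : ℝ} (hB : 0 ≤ B)
    (hu : ∀ x, X.IsFace x → |u x| ≤ B) (V : Finset (Fin d)) :
    ∃ v : (∀ i, Ω i) → ℝ, X.expect (fun x => v x ^ 4) ≤ X.expect (fun x => u x ^ 4) ∧
      (∀ x, X.IsFace x → |v x| ≤ 2 ^ V.card * B) ∧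
      X.norm₂ (v - ∑ S ∈ V.powerset, (∏ i ∈ S, b i) •
        moebius (fun T => X.average (T ∪ Vᶜ) u) S) ≤ 4 ^ V.card * (κ * X.norm₂ u) := by
  have hn : 0 ≤ κ * X.norm₂ u := mul_nonneg hκ (X.norm₂_nonneg u)
  induction V using Finset.induction_on with
  | empty =>
    refine ⟨X.average univ u, (X.expect_congr fun x hx => by rw [X.average_univ hx]).le,
      fun x hx => by simpa using X.abs_average_le hB hu x, ?_⟩
    have : X.average univ u - ∑ S ∈ (∅ : Finset (Fin d)).powerset, (∏ i ∈ S, b i) •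
        moebius (fun T => X.average (T ∪ ∅ᶜ) u) S = 0 := by
      simp [moebius]
    rw [this]
    simpa [norm₂] using hn
  | insert a V ha ih =>
    obtain ⟨v, hv4, hvB, hv⟩ := ih
    set E := X.average (univ.erase a)
    set F : Finset (Fin d) → (∀ i, Ω i) → ℝ := fun T => X.average (T ∪ Vᶜ) u
    set F' : Finset (Fin d) → (∀ i, Ω i) → ℝ := fun T => X.average (T ∪ (insert a V)ᶜ) u
    set Ψ := ∑ S ∈ V.powerset, (∏ i ∈ S, b i) • moebius F S
    set Ψ' := ∑ S ∈ V.powerset, (∏ i ∈ S, b i) • moebius F' S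
    refine ⟨fun x => E v x + b a * (v x - E v x), (X.expect_pow_four_le _ v (hb a)).trans hv4,
      fun x hx => ?_, ?_⟩
    · have h1 := X.abs_average_le (T := univ.erase a) (by positivity) hvB x
      have h2 := hvB x hx
      have h3 := hb a
      have e : E v x + b a * (v x - E v x) = (1 - b a) * E v x + b a * v x := by ring
      have h4 : |1 - b a| ≤ 5 / 4 := by
        rw [abs_le] at h3 ⊢; constructor <;> linarith
      rw [card_insert_of_notMem ha, pow_succ]
      beta_reduce
      rw [e]
      refine (abs_add_le _ _).trans ?_
      rw [abs_mul, abs_mul]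
      have h5 := mul_le_mul h4 h1 (abs_nonneg _) (by norm_num)
      have h6 := mul_le_mul h3 h2 (abs_nonneg _) (by norm_num)
      have : 0 ≤ 2 ^ V.card * B := by positivity
      linarith
    · have eΨ : ∑ S ∈ (insert a V).powerset, (∏ i ∈ S, b i) • moebius F' S
          = (1 - b a) • Ψ' + b a • Ψ := by
        rw [sum_powerset_insert ha, sub_smul, one_smul, sub_add_eq_add_sub, add_sub_assoc]
        congr 1
        rw [← smul_sub, ← sum_sub_distrib, smul_sum]
        refine sum_congr rfl fun S hS => ?_
        have hSV := mem_powerset.1 hS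
        have haS : a ∉ S := fun hc => ha (hSV hc)
        rw [prod_insert haS, moebius_insert _ haS, mul_smul, ← smul_sub]
        congr 3
        refine moebius_congr fun T hT => ?_
        have : insert a T ∪ (insert a V)ᶜ = T ∪ Vᶜ := by
          ext k
          by_cases hk : k = a
          · subst hk; simp [ha]
          · simp [hk]
        simp only [F, F', this]
      have eE : E Ψ - Ψ' = ∑ S ∈ V.powerset, (∏ i ∈ S, b i) •
          moebius (fun T => E (F T) - F' T) S := by
        have : E Ψ = ∑ S ∈ V.powerset, (∏ i ∈ S, b i) • moebius (fun T => E (F T)) S := by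
          change X.averageLM _ Ψ = _
          rw [map_sum]
          refine sum_congr rfl fun S _ => ?_
          rw [map_smul, map_moebius]
          rfl
        rw [this, ← sum_sub_distrib]
        exact sum_congr rfl fun S _ => by rw [moebius_sub, smul_sub]
      have nE : X.norm₂ (E Ψ - Ψ') ≤ 4 ^ V.card * (κ * X.norm₂ u) := by
        rw [eE]
        refine (X.norm₂_sum_le _ _).trans ((sum_le_card_nsmul _ _
          (2 ^ V.card * (κ * X.norm₂ u)) fun S hS => ?_).trans_eq ?_)
        · have hSV := mem_powerset.1 hS
          rw [norm₂_smul]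
          refine (mul_le_of_le_one_left (X.norm₂_nonneg _) (abs_prod_le_one hb S)).trans
            ((X.norm₂_moebius_le (B := κ * X.norm₂ u) fun T hT => ?_).trans ?_)
          · have : T ∪ (insert a V)ᶜ = (T ∪ Vᶜ) ∩ univ.erase a := by
              ext k
              by_cases hk : k = a
              · subst hk
                have : k ∉ T := fun hc => ha (hSV (hT hc))
                simp [this]
              · simp [hk]
            simp only [F, F', this, E]
            exact X.norm₂_average_average_sub_le h hκ _ _ u
          · exact mul_le_mul_of_nonneg_right (pow_le_pow_right₀ one_le_two (card_le_card hSV)) hn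
        · rw [card_powerset, nsmul_eq_mul, show (4 : ℝ) = 2 * 2 by norm_num, mul_pow]
          push_cast
          ring
      have e : (fun x => E v x + b a * (v x - E v x))
          - ∑ S ∈ (insert a V).powerset, (∏ i ∈ S, b i) • moebius F' S
          = (1 - b a) • (E (v - Ψ) + (E Ψ - Ψ')) + b a • (v - Ψ) := by
        rw [eΨ, show E (v - Ψ) = E v - E Ψ from X.average_sub _ _ _]
        ext x
        simp only [Pi.sub_apply, Pi.add_apply, Pi.smul_apply, smul_eq_mul]
        ring
      have h3 := hb a
      have h4 : |1 - b a| ≤ 5 / 4 := by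
        rw [abs_le] at h3 ⊢; constructor <;> linarith
      have h5 : X.norm₂ (E (v - Ψ) + (E Ψ - Ψ')) ≤ 2 * (4 ^ V.card * (κ * X.norm₂ u)) := by
        refine (X.norm₂_add_le _ _).trans ?_
        have := (X.norm₂_average_le (univ.erase a) (v - Ψ)).trans hv
        linarith
      rw [e, card_insert_of_notMem ha, pow_succ]
      refine (X.norm₂_add_le _ _).trans ?_
      rw [norm₂_smul, norm₂_smul]
      have h6 := mul_le_mul h4 h5 (X.norm₂_nonneg _) (by norm_num)
      have h7 := mul_le_mul h3 hv (X.norm₂_nonneg _) (by norm_num)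
      have : 0 ≤ 4 ^ V.card * (κ * X.norm₂ u) := by positivity
      linarith

/-- The multiplier is bounded on `L⁴`, up to a small additive error for bounded functions. -/
theorem expect_multiplier_pow_four_le {κ : ℝ} (h : X.ApproxIndependent κ) (hκ : 0 ≤ κ)
    {b : Fin d → ℝ} (hb : ∀ i, |b i| ≤ 1 / 4) {u : (∀ i, Ω i) → ℝ} {B : ℝ} (hB : 0 ≤ B)
    (hu : ∀ x, X.IsFace x → |u x| ≤ B) :
    X.expect (fun x => X.multiplier b u x ^ 4)
      ≤ 8 * X.expect (fun x => u x ^ 4) + 32 * 256 ^ d * κ ^ 2 * B ^ 4 := by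
  obtain ⟨v, hv4, hvB, hv⟩ := X.exists_contraction_near_multiplier h hκ hb hB hu univ
  have e : ∑ S ∈ (univ : Finset (Fin d)).powerset, (∏ i ∈ S, b i) •
      moebius (fun T => X.average (T ∪ univᶜ) u) S = X.multiplier b u := by
    simp [multiplier, efronStein_eq_moebius]
  rw [e, card_univ, Fintype.card_fin] at hv
  rw [card_univ, Fintype.card_fin] at hvB
  have hm : ∀ x, |X.multiplier b u x| ≤ 4 ^ d * B := by
    intro x
    rw [multiplier, Finset.sum_apply]
    refine (abs_sum_le_sum_abs _ _).trans ((sum_le_card_nsmul _ _ (2 ^ d * B)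
      fun S _ => ?_).trans_eq ?_)
    · rw [Pi.smul_apply, smul_eq_mul, abs_mul]
      exact (mul_le_of_le_one_left (abs_nonneg _) (abs_prod_le_one hb S)).trans
        (X.abs_efronStein_le hB hu S x)
    · rw [card_univ, Fintype.card_finset, Fintype.card_fin, nsmul_eq_mul,
        show (4 : ℝ) = 2 * 2 by norm_num, mul_pow]
      push_cast
      ring
  set e := v - X.multiplier b u
  have he : ∀ x, X.IsFace x → e x ^ 2 ≤ (2 * 4 ^ d * B) ^ 2 := by
    intro x hx
    have h1 := hvB x hx
    have h2 := hm x
    have h3 : (2 : ℝ) ^ d * B ≤ 4 ^ d * B := by gcongr; norm_num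
    apply sq_le_sq'
    · simp only [e, Pi.sub_apply]; linarith [(abs_le.1 h1).1, (abs_le.1 h2).2]
    · simp only [e, Pi.sub_apply]; linarith [(abs_le.1 h1).2, (abs_le.1 h2).1]
  -- The error is small only in `L²`; a crude sup bound upgrades this to `L⁴`.
  have he4 : X.expect (fun x => e x ^ 4) ≤ (2 * 4 ^ d * B) ^ 2 * (4 ^ d * (κ * B)) ^ 2 := by
    calc _ ≤ X.expect fun x => (2 * 4 ^ d * B) ^ 2 * (e x * e x) :=
          X.expect_mono fun x hx => by
            have := mul_le_mul_of_nonneg_right (he x hx) (sq_nonneg (e x))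
            linarith
      _ = (2 * 4 ^ d * B) ^ 2 * X.norm₂ e ^ 2 := by rw [expect_const_mul, norm₂_sq, inner]
      _ ≤ _ := by
          have := X.norm₂_le_of_abs_le hB hu
          have h0 := X.norm₂_nonneg e
          gcongr
          exact hv.trans (by gcongr)
  calc _ ≤ X.expect fun x => 8 * v x ^ 4 + 8 * e x ^ 4 := X.expect_mono fun x _ => by
        have : X.multiplier b u x = v x - e x := by simp [e]
        rw [this]
        nlinarith [sq_nonneg (v x ^ 2 - e x ^ 2), sq_nonneg (v x + e x),
          sq_nonneg ((v x + e x) ^ 2), mul_nonneg (sq_nonneg (v x + e x)) (sq_nonneg (v x - e x))]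
    _ = 8 * X.expect (fun x => v x ^ 4) + 8 * X.expect (fun x => e x ^ 4) := by
        rw [expect_add, expect_const_mul, expect_const_mul]
    _ ≤ 8 * X.expect (fun x => u x ^ 4) + 8 * ((2 * 4 ^ d * B) ^ 2 * (4 ^ d * (κ * B)) ^ 2) := by
        gcongr
    _ = _ := by
        rw [show (256 : ℝ) ^ d = (4 ^ d) ^ 4 by rw [← pow_mul, mul_comm d, pow_mul]; norm_num]
        ring

/-! ### Square functions by averaging over random signs -/

/-- The multiplier with coefficients `± 1/4`, the minus signs being on `R`. -/
def signedNoise (R : Finset (Fin d)) (u : (∀ i, Ω i) → ℝ) : (∀ i, Ω i) → ℝ :=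
  X.multiplier (fun i => 1 / 4 * sign R i) u

theorem signedNoise_apply (R : Finset (Fin d)) (u : (∀ i, Ω i) → ℝ) (x : ∀ i, Ω i) :
    X.signedNoise R u x
      = ∑ S : Finset (Fin d), walsh R S * ((1 / 4) ^ S.card * X.efronStein S u x) := by
  rw [signedNoise, multiplier, Finset.sum_apply]
  refine sum_congr rfl fun S _ => ?_
  rw [Pi.smul_apply, smul_eq_mul, prod_mul_distrib, prod_const, walsh]
  ring

theorem expect_signedNoise_pow_four_le {κ : ℝ} (h : X.ApproxIndependent κ) (hκ : 0 ≤ κ)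
    (R : Finset (Fin d)) {u : (∀ i, Ω i) → ℝ} {B : ℝ} (hB : 0 ≤ B)
    (hu : ∀ x, X.IsFace x → |u x| ≤ B) :
    X.expect (fun x => X.signedNoise R u x ^ 4)
      ≤ 8 * X.expect (fun x => u x ^ 4) + 32 * 256 ^ d * κ ^ 2 * B ^ 4 :=
  X.expect_multiplier_pow_four_le h hκ (fun i => by rw [abs_mul, abs_sign]; norm_num) hB hu

theorem card_finset_fin : ((univ : Finset (Finset (Fin d))).card : ℝ) = 2 ^ d := by
  rw [card_univ, Fintype.card_finset, Fintype.card_fin]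
  push_cast
  rfl

theorem sum_inv_two_pow : ∑ _R : Finset (Fin d), ((2 : ℝ) ^ d)⁻¹ = 1 := by
  rw [sum_const, nsmul_eq_mul, card_finset_fin, mul_inv_cancel₀ (by positivity)]

theorem pow_mean_le {n : ℕ} (hn : Even n) (a : Finset (Fin d) → ℝ) :
    (((2 : ℝ) ^ d)⁻¹ * ∑ R, a R) ^ n ≤ ((2 : ℝ) ^ d)⁻¹ * ∑ R, a R ^ n := by
  rw [mul_sum, mul_sum]
  exact Real.pow_arith_mean_le_arith_mean_pow_of_even univ _ a (fun _ _ => by positivity)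
    sum_inv_two_pow hn

/-- The damped square function `∑_S 16^{-|S|} f^{=S}(x)²`. -/
def squareFunction (f : (∀ i, Ω i) → ℝ) (x : ∀ i, Ω i) : ℝ :=
  ∑ S : Finset (Fin d), (1 / 16) ^ S.card * X.efronStein S f x ^ 2

theorem expect_squareFunction_sq_le {κ : ℝ} (h : X.ApproxIndependent κ) (hκ : 0 ≤ κ)
    {f : (∀ i, Ω i) → ℝ} {B : ℝ} (hB : 0 ≤ B) (hf : ∀ x, X.IsFace x → |f x| ≤ B) :
    X.expect (fun x => X.squareFunction f x ^ 2)
      ≤ 8 * X.expect (fun x => f x ^ 4) + 32 * 256 ^ d * κ ^ 2 * B ^ 4 := by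
  -- Parseval in the signs, with `16 = 4²`.
  have e : ∀ x, X.squareFunction f x = ((2 : ℝ) ^ d)⁻¹ * ∑ R, X.signedNoise R f x ^ 2 := by
    intro x
    simp only [signedNoise_apply]
    rw [sum_sum_walsh_sq, Fintype.card_fin, inv_mul_cancel_left₀ (by positivity), squareFunction]
    refine sum_congr rfl fun S _ => ?_
    rw [mul_pow, ← pow_mul, mul_comm S.card, pow_mul]
    norm_num
  calc _ ≤ X.expect fun x => ((2 : ℝ) ^ d)⁻¹ * ∑ R, X.signedNoise R f x ^ 4 :=
        X.expect_mono fun x _ => by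
          rw [e]
          refine (pow_mean_le even_two _).trans_eq ?_
          simp only [← pow_mul, Nat.reduceMul]
    _ ≤ ((2 : ℝ) ^ d)⁻¹ * ∑ _R : Finset (Fin d),
          (8 * X.expect (fun x => f x ^ 4) + 32 * 256 ^ d * κ ^ 2 * B ^ 4) := by
        rw [expect_const_mul, expect_sum]
        gcongr with R
        exact X.expect_signedNoise_pow_four_le h hκ R hB hf
    _ = _ := by
        rw [sum_const, nsmul_eq_mul, card_finset_fin, inv_mul_cancel_left₀ (by positivity)]

/-- A dual square function estimate. The weights `4^{|S|}` in `u R` undo the noise, and averaging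
over signs removes exactly the cross terms `(G_S')^{=S}` with `S ≠ S'`. Bonami then bounds the sign
average of `(u R)⁴` pointwise; writing `4 = (1/2) · 8` produces the weight `64 = 8²`. -/
theorem expect_sum_efronStein_pow_four_le {κ : ℝ} (h : X.ApproxIndependent κ) (hκ : 0 ≤ κ)
    {G : Finset (Fin d) → (∀ i, Ω i) → ℝ} {B : ℝ} (hB : 0 ≤ B)
    (hG : ∀ S x, X.IsFace x → |G S x| ≤ B) :
    X.expect (fun x => (∑ S, X.efronStein S (G S) x) ^ 4)
      ≤ 8 * X.expect (fun x => (∑ S, 64 ^ S.card * G S x ^ 2) ^ 2)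
        + 32 * 256 ^ d * κ ^ 2 * (8 ^ d * B) ^ 4 := by
  set u : Finset (Fin d) → (∀ i, Ω i) → ℝ := fun R => ∑ S, (4 ^ S.card * walsh R S) • G S
  have hux : ∀ R x, u R x = ∑ S, 4 ^ S.card * walsh R S * G S x := by
    intro R x; simp [u]
  have hu : ∀ R x, X.IsFace x → |u R x| ≤ 8 ^ d * B := by
    intro R x hx
    rw [hux]
    refine (abs_sum_le_sum_abs _ _).trans ((sum_le_card_nsmul _ _ (4 ^ d * B)
      fun S _ => ?_).trans_eq ?_)
    · rw [abs_mul, abs_mul, abs_walsh, mul_one, abs_of_nonneg (by positivity)]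
      gcongr
      · norm_num
      · exact (card_le_univ S).trans_eq (Fintype.card_fin d)
      · exact hG S x hx
    · rw [nsmul_eq_mul, card_finset_fin, ← mul_assoc, ← mul_pow]
      norm_num
  have e : ∀ x, ∑ S, X.efronStein S (G S) x = ((2 : ℝ) ^ d)⁻¹ * ∑ R, X.signedNoise R (u R) x := by
    intro x
    have hES : ∀ R S, X.efronStein S (u R) x
        = ∑ S', 4 ^ S'.card * walsh R S' * X.efronStein S (G S') x := by
      intro R S
      rw [← efronSteinLM_apply, map_sum, Finset.sum_apply]
      refine sum_congr rfl fun S' _ => ?_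
      rw [map_smul, Pi.smul_apply, smul_eq_mul, efronSteinLM_apply]
    simp only [signedNoise_apply, hES, mul_sum]
    rw [sum_comm]
    refine sum_congr rfl fun S _ => ?_
    rw [sum_comm]
    have : ∀ S', ∑ R : Finset (Fin d), ((2 : ℝ) ^ d)⁻¹ * (walsh R S * ((1 / 4) ^ S.card *
        (4 ^ S'.card * walsh R S' * X.efronStein S (G S') x)))
        = if S = S' then X.efronStein S (G S) x else 0 := by
      intro S'
      have : ∀ R : Finset (Fin d), ((2 : ℝ) ^ d)⁻¹ * (walsh R S * ((1 / 4) ^ S.card *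
        (4 ^ S'.card * walsh R S' * X.efronStein S (G S') x)))
        = ((2 : ℝ) ^ d)⁻¹ * ((1 / 4) ^ S.card * 4 ^ S'.card * X.efronStein S (G S') x)
          * (walsh R S * walsh R S') := fun R => by ring
      simp only [this]
      rw [← mul_sum, sum_walsh_mul_walsh, Fintype.card_fin]
      split_ifs with hS
      · subst hS
        rw [← mul_pow]
        norm_num
        field_simp
      · simp
    simp only [this, sum_ite_eq, mem_univ, if_true]
  calc _ ≤ X.expect fun x => ((2 : ℝ) ^ d)⁻¹ * ∑ R, X.signedNoise R (u R) x ^ 4 :=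
        X.expect_mono fun x _ => by
          rw [e]
          exact pow_mean_le (by decide) _
    _ ≤ ((2 : ℝ) ^ d)⁻¹ * ∑ R : Finset (Fin d),
          (8 * X.expect (fun x => u R x ^ 4) + 32 * 256 ^ d * κ ^ 2 * (8 ^ d * B) ^ 4) := by
        rw [expect_const_mul, expect_sum]
        gcongr with R
        exact X.expect_signedNoise_pow_four_le h hκ R (by positivity) (hu R)
    _ = 8 * X.expect (fun x => ((2 : ℝ) ^ d)⁻¹ * ∑ R, u R x ^ 4)
          + 32 * 256 ^ d * κ ^ 2 * (8 ^ d * B) ^ 4 := by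
        rw [sum_add_distrib, sum_const, nsmul_eq_mul, card_finset_fin, mul_add,
          inv_mul_cancel_left₀ (by positivity), ← mul_sum, expect_const_mul, expect_sum]
        ring
    _ ≤ _ := by
        gcongr
        refine X.expect_mono fun x _ => ?_
        rw [inv_mul_le_iff₀ (by positivity)]
        have hb := bonami (univ : Finset (Fin d)) fun S => 8 ^ S.card * G S x
        simp only [powerset_univ, card_univ, Fintype.card_fin] at hb
        refine (Eq.le ?_).trans (hb.trans_eq ?_)
        · refine sum_congr rfl fun R _ => ?_
          rw [hux]
          congr 1
          refine sum_congr rfl fun S _ => ?_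
          rw [show (4 : ℝ) = 1 / 2 * 8 by norm_num, mul_pow]
          ring
        · congr 2
          refine sum_congr rfl fun S _ => ?_
          rw [mul_pow, ← pow_mul, mul_comm S.card, pow_mul]
          norm_num

/-- Averaging out a coordinate of `S` would annihilate the component exactly if the averages
intersected exactly: `T ∩ ([d] ∖ {i})` ignores `i`, so the Möbius sum cancels. -/
theorem abs_inner_average_efronStein_le {κ : ℝ} (h : X.ApproxIndependent κ) (hκ : 0 ≤ κ)
    {i : Fin d} {S : Finset (Fin d)} (hi : i ∈ S) (f g : (∀ i, Ω i) → ℝ) :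
    |X.inner (X.efronStein S g) (X.average (univ.erase i) f)|
      ≤ 2 ^ d * (κ * (X.norm₂ g * X.norm₂ f)) := by
  have h0 : moebius (fun T => X.inner (X.average (T ∩ univ.erase i) g) f) S = 0 :=
    moebius_eq_zero hi fun T _ => by rw [insert_inter_of_notMem (notMem_erase i univ)]
  rw [inner_efronStein_left, ← sub_zero (moebius _ S), ← h0, ← moebius_sub]
  exact (abs_moebius_le fun T _ => h T (univ.erase i) g f).trans
    (mul_le_mul_of_nonneg_right (two_pow_card_le S)
      (mul_nonneg hκ (mul_nonneg (X.norm₂_nonneg g) (X.norm₂_nonneg f))))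

/-! ### Local influences of a Boolean function -/

open Classical in
/-- The squares of the components of degree at most `n` that involve the coordinate `i`. -/
def localInfluence (n : ℕ) (f : (∀ i, Ω i) → ℝ) (i : Fin d) (x : ∀ i, Ω i) : ℝ :=
  ∑ S : Finset (Fin d), if i ∈ S ∧ S.card ≤ n then X.efronStein S f x ^ 2 else 0

theorem localInfluence_nonneg (n : ℕ) (f : (∀ i, Ω i) → ℝ) (i : Fin d) (x : ∀ i, Ω i) :
    0 ≤ X.localInfluence n f i x :=
  sum_nonneg fun S _ => by split_ifs <;> positivity

theorem sum_localInfluence_le (n : ℕ) (f : (∀ i, Ω i) → ℝ) (x : ∀ i, Ω i) :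
    ∑ i, X.localInfluence n f i x ≤ n * (16 ^ n * X.squareFunction f x) := by
  simp only [localInfluence, squareFunction]
  rw [sum_comm, mul_sum, mul_sum]
  refine sum_le_sum fun S _ => ?_
  rw [← sum_filter, sum_const, nsmul_eq_mul]
  by_cases hS : S.card ≤ n
  · have h1 : (univ.filter fun i => i ∈ S ∧ S.card ≤ n) = S := by ext; simp [hS]
    have h2 : (1 : ℝ) ≤ 16 ^ n * (1 / 16) ^ S.card := by
      rw [one_div, inv_pow, ← div_eq_mul_inv, one_le_div (by positivity)]
      exact pow_le_pow_right₀ (by norm_num) hS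
    rw [h1]
    have h3 : (S.card : ℝ) ≤ n := by exact_mod_cast hS
    refine mul_le_mul h3 ?_ (sq_nonneg _) (by positivity)
    rw [← mul_assoc]
    exact le_mul_of_one_le_left (sq_nonneg _) h2
  · have h1 : (univ.filter fun i => i ∈ S ∧ S.card ≤ n) = ∅ := by ext; simp [hS]
    rw [h1]
    simp
    positivity

theorem sum_low_degree_le (n : ℕ) (f : (∀ i, Ω i) → ℝ) (x : ∀ i, Ω i) :
    ∑ S : Finset (Fin d), (if S.card ≤ n then X.efronStein S f x ^ 2 else 0)
      ≤ 16 ^ n * X.squareFunction f x := by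
  rw [squareFunction, mul_sum]
  refine sum_le_sum fun S _ => ?_
  split_ifs with hS
  · have h2 : (1 : ℝ) ≤ 16 ^ n * (1 / 16) ^ S.card := by
      rw [one_div, inv_pow, ← div_eq_mul_inv, one_le_div (by positivity)]
      exact pow_le_pow_right₀ (by norm_num) hS
    rw [← mul_assoc]
    exact le_mul_of_one_le_left (sq_nonneg _) h2
  · positivity

theorem le_add_inv_pow_mul_pow_four {a t : ℝ} (ha : 0 ≤ a) (ht : 0 < t) :
    a ≤ t + (t ^ 3)⁻¹ * a ^ 4 := by
  rcases le_total a t with h | h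
  · have : 0 ≤ (t ^ 3)⁻¹ * a ^ 4 := by positivity
    linarith
  · have h3 : t ^ 3 ≤ a ^ 3 := pow_le_pow_left₀ ht.le h 3
    have : a ≤ (t ^ 3)⁻¹ * a ^ 4 := by
      rw [← div_eq_inv_mul, le_div_iff₀ (by positivity)]
      nlinarith
    linarith

theorem abs_laplacian_eq {f : (∀ i, Ω i) → ℝ} (hf : ∀ x, X.IsFace x → f x = 1 ∨ f x = -1)
    (i : Fin d) {x : ∀ i, Ω i} (hx : X.IsFace x) :
    |X.laplacian i f x| = f x * X.laplacian i f x ∧ |X.laplacian i f x| ≤ 2 := by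
  have hm : |X.average (univ.erase i) f x| ≤ 1 :=
    X.abs_average_le zero_le_one (fun y hy => by rcases hf y hy with h | h <;> simp [h]) x
  obtain ⟨h1, h2⟩ := abs_le.1 hm
  rw [laplacian]
  rcases hf x hx with h | h
  · rw [h, abs_of_nonneg (by linarith)]
    constructor <;> linarith
  · rw [h, abs_of_nonpos (by linarith)]
    constructor <;> linarith

open Classical in
/-- For a `±1`-valued function, the part of the low-degree influence of `i` that comes from points where it
is small is itself small. -/
theorem expect_localInfluence_le {κ : ℝ} (h : X.ApproxIndependent κ) (hκ : 0 ≤ κ)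
    {f : (∀ i, Ω i) → ℝ} (hf : ∀ x, X.IsFace x → f x = 1 ∨ f x = -1) (n : ℕ) (i : Fin d)
    {t : ℝ} (ht : 0 < t) :
    X.expect (fun x => if X.localInfluence n f i x < t ^ 3 / (32 * 4096 ^ n)
        then X.localInfluence n f i x else 0)
      ≤ 2 * t * X.inner f (X.laplacian i f)
        + (128 * (t ^ 3)⁻¹ * 256 ^ d * κ ^ 2 * 65536 ^ d + 2 * 8 ^ d * κ) := by
  set τ : ℝ := t ^ 3 / (32 * 4096 ^ n)
  set g := X.localInfluence n f i
  set A := X.expect fun x => if g x < τ then g x else 0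
  set G : Finset (Fin d) → (∀ i, Ω i) → ℝ := fun S x =>
    if g x < τ then (if i ∈ S ∧ S.card ≤ n then X.efronStein S f x else 0) else 0
  set H : (∀ i, Ω i) → ℝ := ∑ S, X.efronStein S (G S)
  have hf1 : ∀ x, X.IsFace x → |f x| ≤ 1 := fun x hx => by
    rcases hf x hx with h | h <;> simp [h]
  have hGB : ∀ S x, X.IsFace x → |G S x| ≤ 2 ^ d := by
    intro S x _
    simp only [G]
    split_ifs
    · simpa using X.abs_efronStein_le zero_le_one hf1 S x
    · simp
    · simp
  -- The cutoff is placed inside `G S`, and the self-adjointness of `f ↦ f^{=S}` moves the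
  -- projection onto it.
  have hAH : A = X.inner f H := by
    have e : ∀ x, (if g x < τ then g x else 0) = ∑ S, X.efronStein S f x * G S x := by
      intro x
      simp only [G]
      split_ifs with hx
      · simp only [g, localInfluence]
        refine sum_congr rfl fun S _ => ?_
        split_ifs <;> ring
      · simp
    simp only [A, e]
    rw [expect_sum, X.inner_comm, inner_sum_left]
    refine sum_congr rfl fun S _ => ?_
    rw [X.inner_comm, ← inner_efronStein_comm]
    rfl
  have hH4 : X.expect (fun x => H x ^ 4)
      ≤ 8 * (4096 ^ n * (τ * A)) + 32 * 256 ^ d * κ ^ 2 * 65536 ^ d := by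
    have h1 := X.expect_sum_efronStein_pow_four_le h hκ (by positivity) hGB
    have e : ∀ x, H x = ∑ S, X.efronStein S (G S) x := fun x => by simp [H]
    simp only [e]
    refine h1.trans (add_le_add (mul_le_mul_of_nonneg_left ?_ (by norm_num)) (Eq.le ?_))
    · simp only [A]
      rw [← expect_const_mul, ← expect_const_mul]
      refine X.expect_mono fun x _ => ?_
      simp only [G]
      split_ifs with hx
      · have h2 : ∑ S : Finset (Fin d), 64 ^ S.card *
            (if i ∈ S ∧ S.card ≤ n then X.efronStein S f x else 0) ^ 2 ≤ 64 ^ n * g x := by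
          simp only [g, localInfluence, mul_sum]
          refine sum_le_sum fun S _ => ?_
          split_ifs with hS
          · gcongr
            · norm_num
            · exact hS.2
          · simp
        have h3 : 0 ≤ g x := X.localInfluence_nonneg n f i x
        calc _ ≤ (64 ^ n * g x) ^ 2 := by
              gcongr
          _ = 4096 ^ n * (g x * g x) := by
              rw [mul_pow, ← pow_mul, mul_comm n, pow_mul]
              norm_num
              ring
          _ ≤ _ := by gcongr
      · simp
    · have : (8 ^ d * 2 ^ d : ℝ) ^ 4 = 65536 ^ d := by
        rw [← mul_pow, ← pow_mul, mul_comm d, pow_mul]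
        norm_num
      rw [this]
  have hI : X.inner f (X.laplacian i f) = X.expect fun x => |X.laplacian i f x| :=
    X.expect_congr fun x hx => (X.abs_laplacian_eq hf i hx).1.symm
  -- Only sets containing `i` enter `H`, so the second term is pure error.
  have hsplit : X.inner f H = X.inner (X.laplacian i f) H
      + X.inner H (X.average (univ.erase i) f) := by
    have : X.laplacian i f = f - X.average (univ.erase i) f := rfl
    rw [this, inner_sub_left, X.inner_comm H]
    ring
  have hmain : X.inner (X.laplacian i f) H
      ≤ t * X.inner f (X.laplacian i f) + 2 * (t ^ 3)⁻¹ * X.expect fun x => H x ^ 4 := by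
    rw [hI, ← expect_const_mul, ← expect_const_mul, ← expect_add]
    refine X.expect_mono fun x hx => ?_
    have h1 := le_add_inv_pow_mul_pow_four (abs_nonneg (H x)) ht
    have h2 := (X.abs_laplacian_eq hf i hx).2
    have h3 : |H x| ^ 4 = H x ^ 4 := (by decide : Even 4).pow_abs _
    rw [h3] at h1
    have h4 := mul_le_mul_of_nonneg_left h1 (abs_nonneg (X.laplacian i f x))
    have h5 : 0 ≤ (t ^ 3)⁻¹ * H x ^ 4 := by positivity
    have h6 := mul_le_mul_of_nonneg_right h2 h5
    have h7 := le_abs_self (X.laplacian i f x * H x)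
    rw [abs_mul] at h7
    linarith
  have herr : X.inner H (X.average (univ.erase i) f) ≤ 8 ^ d * κ := by
    rw [inner_sum_left]
    refine (sum_le_card_nsmul _ _ (2 ^ d * (κ * 2 ^ d)) fun S _ => ?_).trans_eq ?_
    · by_cases hS : i ∈ S
      · refine (le_abs_self _).trans ((X.abs_inner_average_efronStein_le h hκ hS f (G S)).trans ?_)
        have h1 := X.norm₂_le_of_abs_le (by positivity) (hGB S)
        have h2 := X.norm₂_le_of_abs_le zero_le_one hf1
        have h3 := mul_le_mul h1 h2 (X.norm₂_nonneg _) (by positivity)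
        rw [mul_one] at h3
        gcongr
      · have : G S = 0 := by
          ext x
          simp [G, hS]
        rw [this, ← efronSteinLM_apply, map_zero]
        have : X.inner (0 : (∀ i, Ω i) → ℝ) (X.average (univ.erase i) f) = 0 :=
          (X.innerLM _).map_zero
        rw [this]
        positivity
    · rw [nsmul_eq_mul, card_finset_fin, show (8 : ℝ) = 2 * 2 * 2 by norm_num, mul_pow, mul_pow]
      ring
  -- The threshold is chosen so that exactly half of `A` returns on the right and can be absorbed.
  have hτ : 2 * (t ^ 3)⁻¹ * (8 * (4096 ^ n * (τ * A))) = A / 2 := by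
    simp only [τ]
    field_simp
    norm_num
  have h8 := mul_le_mul_of_nonneg_left hH4 (by positivity : 0 ≤ 2 * (t ^ 3)⁻¹)
  rw [mul_add, hτ] at h8
  linarith

/-! ### Total influence against variance and high degree -/

theorem norm₂_eq_one {f : (∀ i, Ω i) → ℝ} (hf : ∀ x, X.IsFace x → f x = 1 ∨ f x = -1) :
    X.norm₂ f = 1 := by
  have : X.inner f f = 1 := by
    rw [← X.expect_const 1]
    exact X.expect_congr fun x hx => by rcases hf x hx with h | h <;> simp [h]
  rw [norm₂_eq_sqrt, this, Real.sqrt_one]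

theorem sum_card_mul_le {e : ℝ} (he : 0 ≤ e) :
    ∑ S : Finset (Fin d), (S.card : ℝ) * (4 ^ d * e) ≤ d * 8 ^ d * e := by
  refine (sum_le_card_nsmul _ _ (d * (4 ^ d * e)) fun S _ => ?_).trans_eq ?_
  · have : (S.card : ℝ) ≤ d := by exact_mod_cast (card_le_univ S).trans_eq (Fintype.card_fin d)
    gcongr
  · rw [nsmul_eq_mul, card_finset_fin, show (8 : ℝ) = 2 * 4 by norm_num, mul_pow]
    ring

theorem inner_efronStein_add_nonneg {κ : ℝ} (h : X.ApproxIndependent κ) (hκ : 0 ≤ κ)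
    {f : (∀ i, Ω i) → ℝ} (hf : X.norm₂ f = 1) (S : Finset (Fin d)) :
    0 ≤ X.inner (X.efronStein S f) f + 4 ^ d * κ := by
  have := X.norm₂_efronStein_sq_le h hκ S f
  rw [hf, ← norm₂_sq] at this
  nlinarith [sq_nonneg (X.norm₂ (X.efronStein S f))]

theorem variance_le_totalInfluence {κ : ℝ} (h : X.ApproxIndependent κ) (hκ : 0 ≤ κ)
    {f : (∀ i, Ω i) → ℝ} (hf : X.norm₂ f = 1) :
    X.variance f ≤ X.totalInfluence f + d * 8 ^ d * κ := by
  refine le_trans ?_ (add_le_add_right (sum_card_mul_le hκ) _)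
  rw [variance_eq_sum, totalInfluence_eq_sum, ← sum_add_distrib,
    ← add_sum_erase univ _ (mem_univ (∅ : Finset (Fin d)))]
  simp only [card_empty, Nat.cast_zero, zero_mul, zero_add]
  refine sum_le_sum fun S hS => ?_
  have h1 : (1 : ℝ) ≤ S.card := by
    exact_mod_cast card_pos.2 (nonempty_iff_ne_empty.2 (ne_of_mem_erase hS))
  have h2 := X.inner_efronStein_add_nonneg h hκ hf S
  have h3 : 0 ≤ 4 ^ d * κ := by positivity
  rw [← mul_add]
  nlinarith

/-- Components of high degree carry little mass. -/
theorem mul_sum_high_degree_le {κ : ℝ} (h : X.ApproxIndependent κ) (hκ : 0 ≤ κ)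
    {f : (∀ i, Ω i) → ℝ} (hf : X.norm₂ f = 1) {n : ℕ} {l : ℝ} (hl : l ≤ n + 1) :
    l * X.expect (fun x => ∑ S : Finset (Fin d),
      if S.card ≤ n then 0 else X.efronStein S f x ^ 2) ≤ X.totalInfluence f + d * 8 ^ d * κ := by
  refine le_trans ?_ (add_le_add_right (sum_card_mul_le hκ) _)
  rw [totalInfluence_eq_sum, ← sum_add_distrib, expect_sum, mul_sum]
  refine sum_le_sum fun S _ => ?_
  rw [← mul_add]
  have h2 := X.inner_efronStein_add_nonneg h hκ hf S
  split_ifs with hS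
  · rw [expect_const, mul_zero]
    positivity
  -- Degree above `n` means at least `n + 1`, hence at least `l` even when `l` is not an integer.
  · have h1 : l ≤ S.card := hl.trans (by exact_mod_cast not_le.1 hS)
    have h3 := X.norm₂_efronStein_sq_le h hκ S f
    rw [hf] at h3
    have h4 : X.expect (fun x => X.efronStein S f x ^ 2)
        = X.inner (X.efronStein S f) (X.efronStein S f) := by simp only [inner, sq]
    have h5 : 0 ≤ X.inner (X.efronStein S f) (X.efronStein S f) := by
      rw [← norm₂_sq]; positivity
    rw [h4]
    refine (mul_le_mul_of_nonneg_right h1 h5).trans ?_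
    gcongr
    linarith

/-! ### The influential coordinates and the mass they miss -/

open Classical in
/-- The coordinates with large local influence at `x`, if the square function is at most `M` there. -/
def influentialSet (n : ℕ) (τ M : ℝ) (f : (∀ i, Ω i) → ℝ) (x : ∀ i, Ω i) : Finset (Fin d) :=
  if X.squareFunction f x ≤ M then univ.filter fun i => τ ≤ X.localInfluence n f i x else ∅

theorem squareFunction_nonneg (f : (∀ i, Ω i) → ℝ) (x : ∀ i, Ω i) : 0 ≤ X.squareFunction f x :=
  sum_nonneg fun _ _ => by positivity

/-- Markov's inequality over coordinates: each set of degree at most `n` is counted at most `n`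
times in the sum of local influences. -/
theorem card_influentialSet_le {n : ℕ} {τ M : ℝ} (hτ : 0 < τ) (hM : 0 ≤ M)
    (f : (∀ i, Ω i) → ℝ) (x : ∀ i, Ω i) :
    ((X.influentialSet n τ M f x).card : ℝ) ≤ n * (16 ^ n * M) / τ := by
  classical
  rw [influentialSet]
  split_ifs with h
  · rw [le_div_iff₀ hτ, ← nsmul_eq_mul]
    refine (card_nsmul_le_sum _ (fun i => X.localInfluence n f i x) _
      fun i hi => (mem_filter.1 hi).2).trans ?_
    refine (sum_le_sum_of_subset_of_nonneg (filter_subset _ _)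
      fun i _ _ => X.localInfluence_nonneg n f i x).trans ?_
    refine (X.sum_localInfluence_le n f x).trans ?_
    gcongr
  · simp
    positivity

open Classical in
theorem massOutside_influentialSet_le {n : ℕ} {l τ M : ℝ} (hM : 0 < M)
    (hl : ∀ k : ℕ, k ≤ n → (k : ℝ) ≤ l) (f : (∀ i, Ω i) → ℝ) :
    X.massOutside (fun x => smallSubsets (X.influentialSet n τ M f x) l) f
      ≤ X.expect (fun x => ∑ S : Finset (Fin d),
          if S.card ≤ n then 0 else X.efronStein S f x ^ 2)
        + 16 ^ n / M * X.expect (fun x => X.squareFunction f x ^ 2)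
        + ∑ i, X.expect fun x =>
            if X.localInfluence n f i x < τ then X.localInfluence n f i x else 0 := by
  rw [massOutside, ← expect_const_mul, ← expect_sum, ← expect_add, ← expect_add]
  refine X.expect_mono fun x _ => ?_
  have hQ := X.squareFunction_nonneg f x
  have hlow := X.sum_low_degree_le n f x
  have hnn : ∀ i, 0 ≤ if X.localInfluence n f i x < τ then X.localInfluence n f i x else 0 :=
    fun i => by split_ifs <;> [exact X.localInfluence_nonneg n f i x; exact le_rfl]
  by_cases hx : X.squareFunction f x ≤ M
  · have h2 : 0 ≤ 16 ^ n / M * X.squareFunction f x ^ 2 := by positivity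
    have h3 : ∑ S : Finset (Fin d), (if S ∈ smallSubsets (X.influentialSet n τ M f x) l then 0
          else X.efronStein S f x ^ 2)
        ≤ ∑ S : Finset (Fin d), (if S.card ≤ n then 0 else X.efronStein S f x ^ 2)
          + ∑ i, if X.localInfluence n f i x < τ then X.localInfluence n f i x else 0 := by
      have e : ∀ i, (if X.localInfluence n f i x < τ then X.localInfluence n f i x else 0)
          = ∑ S : Finset (Fin d), if X.localInfluence n f i x < τ then
            (if i ∈ S ∧ S.card ≤ n then X.efronStein S f x ^ 2 else 0) else 0 := by
        intro i
        split_ifs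
        · rfl
        · simp
      simp only [e]
      rw [sum_comm (s := (univ : Finset (Fin d))), ← sum_add_distrib]
      refine sum_le_sum fun S _ => ?_
      have hnn' : ∀ i, 0 ≤ if X.localInfluence n f i x < τ then
          (if i ∈ S ∧ S.card ≤ n then X.efronStein S f x ^ 2 else 0) else 0 := fun i => by
        split_ifs <;> positivity
      by_cases hS : S ∈ smallSubsets (X.influentialSet n τ M f x) l
      · rw [if_pos hS]
        exact add_nonneg (by split_ifs <;> positivity) (sum_nonneg fun i _ => hnn' i)
      · rw [if_neg hS]
        by_cases hc : S.card ≤ n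
        · rw [if_pos hc, zero_add]
          -- A low-degree set outside the family contains a non-influential coordinate, whose
          -- truncated local influence pays for it.
          obtain ⟨i, hiS, hi⟩ := not_subset.1 fun hsub => hS ⟨hsub, hl _ hc⟩
          have hi' : X.localInfluence n f i x < τ := by
            simpa [influentialSet, hx] using hi
          refine le_trans ?_ (single_le_sum (fun i _ => hnn' i) (mem_univ i))
          rw [if_pos hi', if_pos ⟨hiS, hc⟩]
        · rw [if_neg hc]
          exact le_add_of_nonneg_right (sum_nonneg fun i _ => hnn' i)
    linarith
  · have h1 : ∑ S : Finset (Fin d), (if S ∈ smallSubsets (X.influentialSet n τ M f x) l then 0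
          else X.efronStein S f x ^ 2)
        ≤ ∑ S : Finset (Fin d), (if S.card ≤ n then 0 else X.efronStein S f x ^ 2)
          + ∑ S : Finset (Fin d), (if S.card ≤ n then X.efronStein S f x ^ 2 else 0) := by
      rw [← sum_add_distrib]
      refine sum_le_sum fun S _ => ?_
      have := sq_nonneg (X.efronStein S f x)
      split_ifs <;> linarith
    -- Where the square function exceeds `M`, all the low-degree mass is given up, Chebyshev style.
    have h2 : 16 ^ n * X.squareFunction f x ≤ 16 ^ n / M * X.squareFunction f x ^ 2 := by
      rw [div_mul_eq_mul_div, mul_div_assoc]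
      gcongr
      rw [le_div_iff₀ hM, sq]
      exact mul_le_mul_of_nonneg_left (not_le.1 hx).le hQ
    have h3 := sum_nonneg fun i (_ : i ∈ univ) => hnn i
    linarith

end PartiteComplex

end

/-! ### Numerical bookkeeping, with `D = 2^d` and `x = d` -/

section Numeric

variable {D γ x : ℝ}

theorem two_pow_mul_pow_mul_le (hD : 2 ≤ D) (hγ : 0 ≤ γ) (j k m : ℕ) (h : j + k ≤ m) :
    2 ^ j * D ^ k * γ ≤ D ^ m * γ := by
  refine mul_le_mul_of_nonneg_right ?_ hγ
  calc _ ≤ D ^ j * D ^ k := by gcongr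
    _ = D ^ (j + k) := (pow_add _ _ _).symm
    _ ≤ D ^ m := pow_le_pow_right₀ (by linarith) h

theorem linear_error_le (hD : 2 ≤ D) (hγ : 0 ≤ γ) (hx : 0 ≤ x) (hxD : x ≤ D) :
    400 * (x * D ^ 3 * (x ^ 2 * γ)) ≤ D ^ 60 * γ := by
  calc _ ≤ 2 ^ 9 * (D * D ^ 3 * (D ^ 2 * γ)) := by gcongr; norm_num
    _ = 2 ^ 9 * D ^ 6 * γ := by ring
    _ ≤ _ := two_pow_mul_pow_mul_le hD hγ 9 6 60 (by norm_num)

theorem quadratic_error_le (hD : 2 ≤ D) (hγ : 0 ≤ γ) (hx : 0 ≤ x) (hxD : x ≤ D)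
    (h : D ^ 60 * γ ≤ 1) : 32 * D ^ 8 * (x ^ 2 * γ) ^ 2 ≤ 1 := by
  have h0 := two_pow_mul_pow_mul_le hD hγ 0 0 60 (by norm_num)
  have h1 := two_pow_mul_pow_mul_le hD hγ 5 12 60 (by norm_num)
  calc _ ≤ 32 * D ^ 8 * (D ^ 2 * γ) ^ 2 := by gcongr
    _ = (2 ^ 5 * D ^ 12 * γ) * γ := by ring
    _ ≤ 1 * 1 := by
        have : 0 ≤ 2 ^ 5 * D ^ 12 * γ := by positivity
        exact mul_le_mul (h1.trans h) (by linarith) hγ zero_le_one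
    _ = 1 := one_mul 1

theorem influence_error_le (hD : 2 ≤ D) (hγ : 0 ≤ γ) (hx : 0 ≤ x) (hxD : x ≤ D)
    (h : D ^ 60 * γ ≤ 1) {l : ℝ} (hl : 0 ≤ l) (hlD : l ≤ D) :
    4 * (x * (128 * (512 * l ^ 3) * D ^ 8 * (x ^ 2 * γ) ^ 2 * D ^ 16 + 2 * D ^ 3 * (x ^ 2 * γ)))
      ≤ D ^ 60 * γ := by
  have h0 := two_pow_mul_pow_mul_le hD hγ 0 0 60 (by norm_num)
  have h1 := two_pow_mul_pow_mul_le hD hγ 18 32 59 (by norm_num)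
  have h2 := two_pow_mul_pow_mul_le hD hγ 3 6 59 (by norm_num)
  have h3 := two_pow_mul_pow_mul_le hD hγ 1 59 60 (by norm_num)
  have h4 : 0 ≤ 2 ^ 18 * D ^ 32 * γ := by positivity
  calc _ ≤ 4 * (D * (128 * (512 * D ^ 3) * D ^ 8 * (D ^ 2 * γ) ^ 2 * D ^ 16
          + 2 * D ^ 3 * (D ^ 2 * γ))) := by gcongr
    _ = (2 ^ 18 * D ^ 32 * γ) * γ + 2 ^ 3 * D ^ 6 * γ := by ring
    _ ≤ (2 ^ 18 * D ^ 32 * γ) * 1 + 2 ^ 3 * D ^ 6 * γ := by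
        gcongr
        linarith
    _ ≤ _ := by linarith

/-- With `Z = 2^l`, the bound `1/ε ≤ 200 l` makes everything polynomial in `Z`. The constant is
below `2^25 ≤ Z^2500` because `l ≥ 1/100`, whence `2525 = 2500 + 25`. -/
theorem junta_size_le {l ε : ℝ} {n : ℕ} (hε : 0 < ε) (hl : 1 / 100 ≤ l) (hn : (n : ℝ) ≤ l)
    (hεl : 1 / 200 ≤ l * ε) :
    n * (16 ^ n * (9 * 16 ^ n / ε)) / ((1 / (8 * l)) ^ 3 / (32 * 4096 ^ n))
      ≤ (2 : ℝ) ^ (2525 * l) := by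
  have hl0 : 0 < l := by linarith
  set Z : ℝ := (2 : ℝ) ^ l
  have hZ0 : 0 < Z := by positivity
  have hZl : l ≤ Z := by
    rcases le_total 1 l with h | h
    · have := one_add_mul_self_le_rpow_one_add (s := 1) (by norm_num) h
      rw [one_add_one_eq_two] at this
      change l ≤ 2 ^ l
      linarith
    · exact h.trans (Real.one_le_rpow one_le_two hl0.le)
  have hZn : (2 : ℝ) ^ n ≤ Z := by
    rw [← Real.rpow_natCast]
    exact Real.rpow_le_rpow_of_exponent_le one_le_two hn
  have hZ2 : 2 ≤ Z ^ 100 := by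
    rw [← Real.rpow_natCast, ← Real.rpow_mul zero_le_two]
    nth_rewrite 1 [← Real.rpow_one 2]
    refine Real.rpow_le_rpow_of_exponent_le one_le_two ?_
    push_cast
    linarith
  have hinv : 1 / ε ≤ 200 * l := by
    rw [div_le_iff₀ hε]
    linarith
  have e : (2 : ℝ) ^ (2525 * l) = Z ^ 2525 := by
    rw [← Real.rpow_natCast, ← Real.rpow_mul zero_le_two, mul_comm]
    norm_num
  have h16 : (16 : ℝ) ^ n = (2 ^ n) ^ 4 := by rw [← pow_mul, mul_comm, pow_mul]; norm_num
  have h4096 : (4096 : ℝ) ^ n = (2 ^ n) ^ 12 := by rw [← pow_mul, mul_comm, pow_mul]; norm_num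
  rw [e, h16, h4096]
  calc _ = 147456 * (n * l ^ 3 * (1 / ε) * (2 ^ n) ^ 20) := by
        field_simp
        ring
    _ ≤ 147456 * (l * l ^ 3 * (200 * l) * Z ^ 20) := by gcongr
    _ = 29491200 * (l ^ 5 * Z ^ 20) := by ring
    _ ≤ 2 ^ 25 * (Z ^ 5 * Z ^ 20) := by gcongr; norm_num
    _ ≤ (Z ^ 100) ^ 25 * (Z ^ 5 * Z ^ 20) := by gcongr
    _ = Z ^ 2525 := by ring

end Numeric

/-! ### Choice of parameters and conclusion -/

open PartiteComplex in
theorem mainTheorem6 :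
    ∃ c C K : ℝ, 0 < c ∧ 0 < C ∧ 0 < K ∧
      ∀ (d : ℕ) (Ω : Fin d → Type*) [∀ i, Fintype (Ω i)] (X : PartiteComplex d Ω) (γ ε : ℝ)
        (f : (∀ i, Ω i) → ℝ),
        0 ≤ γ → X.IsGammaProduct γ → γ ≤ (2 : ℝ) ^ (-(c * (d : ℝ))) →
        (2 : ℝ) ^ (C * (d : ℝ)) * γ < ε → ε < 1 / 2 →
        (∀ x, X.IsFace x → f x = 1 ∨ f x = -1) →
        (1 / 100 : ℝ) ≤ X.variance f →
        ∃ J : (∀ i, Ω i) → Finset (Fin d),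
          (∀ x, ((J x).card : ℝ) ≤ (2 : ℝ) ^ (K * (X.totalInfluence f / ε))) ∧
          X.massOutside (fun x => PartiteComplex.smallSubsets (J x) (X.totalInfluence f / ε)) f
            ≤ 3 * ε := by
  refine ⟨60, 60, 2525, by norm_num, by norm_num, by norm_num, ?_⟩
  intro d Ω _ X γ ε f hγ hX hγc hγε hε2 hf hvar
  have hcast : (2 : ℝ) ^ (60 * (d : ℝ)) = ((2 : ℝ) ^ d) ^ 60 := by
    rw [← pow_mul, mul_comm, ← Real.rpow_natCast]
    norm_num
  rw [Real.rpow_neg zero_le_two, hcast] at hγc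
  rw [hcast] at hγε
  have hε : 0 < ε := lt_of_le_of_lt (mul_nonneg (pow_nonneg (by positivity) 60) hγ) hγε
  set l := X.totalInfluence f / ε
  have hdD : (d : ℝ) ≤ 2 ^ d := by exact_mod_cast d.lt_two_pow_self.le
  -- If `l ≥ d`, all coordinates may be taken. Otherwise `l < d ≤ 2^d`, which keeps powers of `l` in
  -- the error terms under control.
  rcases le_or_gt (d : ℝ) l with hdl | hdl
  · refine ⟨fun _ => Finset.univ, fun x => ?_, ?_⟩
    · rw [Finset.card_univ, Fintype.card_fin]
      refine hdD.trans ?_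
      rw [← Real.rpow_natCast]
      refine Real.rpow_le_rpow_of_exponent_le one_le_two ?_
      have : (0 : ℝ) ≤ d := d.cast_nonneg
      linarith
    · have hmem : ∀ S : Finset (Fin d), S ∈ smallSubsets Finset.univ l := fun S =>
        ⟨Finset.subset_univ S, le_trans
          (by exact_mod_cast (Finset.card_le_univ S).trans_eq (Fintype.card_fin d)) hdl⟩
      simp only [massOutside, hmem, if_true, Finset.sum_const_zero, expect_const]
      positivity
  set D : ℝ := 2 ^ d with hDdef
  set κ : ℝ := (d : ℝ) ^ 2 * γ
  have hd0 : (0 : ℝ) ≤ d := d.cast_nonneg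
  have hκ : 0 ≤ κ := by positivity
  have hI := hX.approxIndependent hγ
  have hf1 := X.norm₂_eq_one hf
  have hD1 : 0 < D := by positivity
  have hDγ : D ^ 60 * γ ≤ 1 := by
    have := mul_le_mul_of_nonneg_left hγc (by positivity : 0 ≤ D ^ 60)
    rwa [mul_inv_cancel₀ (by positivity)] at this
  have h8 : (8 : ℝ) ^ d = D ^ 3 := by rw [hDdef, ← pow_mul, mul_comm, pow_mul]; norm_num
  have h256 : (256 : ℝ) ^ d = D ^ 8 := by rw [hDdef, ← pow_mul, mul_comm, pow_mul]; norm_num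
  have h65536 : (65536 : ℝ) ^ d = D ^ 16 := by rw [hDdef, ← pow_mul, mul_comm, pow_mul]; norm_num
  have hvI := X.variance_le_totalInfluence hI hκ hf1
  have hdpos : d ≠ 0 := by
    rintro rfl
    have : X.totalInfluence f = 0 := by simp [totalInfluence]
    simp [this] at hvI
    linarith
  have hD2 : 2 ≤ D := by
    rw [hDdef]
    exact le_self_pow₀ one_le_two hdpos
  have hη := linear_error_le hD2 hγ hd0 hdD
  rw [h8] at hvI
  -- The variance hypothesis enters here, through the approximate Poincaré inequality; it keeps `l`
  -- away from `0`.
  have hIlow : 1 / 200 ≤ X.totalInfluence f := by linarith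
  have hIl : X.totalInfluence f = l * ε := (div_mul_cancel₀ _ hε.ne').symm
  have hl : 1 / 100 ≤ l := by
    rw [hIl] at hIlow
    by_contra! hc
    nlinarith
  have hl0 : 0 < l := by linarith
  set n := ⌊l⌋₊
  have hnl : (n : ℝ) ≤ l := Nat.floor_le hl0.le
  -- The second moment of the square function is at most `8 + 1`, so this `M` makes its contribution
  -- exactly `ε`.
  set M : ℝ := 9 * 16 ^ n / ε
  have hM : 0 < M := by positivity
  -- Chosen so that `2 t I[f] = ε / 4`.
  set t : ℝ := 1 / (8 * l)
  have ht : 0 < t := by positivity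
  set τ : ℝ := t ^ 3 / (32 * 4096 ^ n)
  have hτ : 0 < τ := by positivity
  refine ⟨X.influentialSet n τ M f, fun x => (X.card_influentialSet_le hτ hM.le f x).trans
    (junta_size_le hε hl hnl (hIl ▸ hIlow)), ?_⟩
  refine (X.massOutside_influentialSet_le hM
    (fun k hk => le_trans (by exact_mod_cast hk) hnl) f).trans ?_
  have hhigh := X.mul_sum_high_degree_le hI hκ hf1 (n := n) (Nat.lt_floor_add_one l).le
  have hfB : ∀ x, X.IsFace x → |f x| ≤ 1 := fun x hx => by
    rcases hf x hx with h | h <;> simp [h]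
  have hmid := X.expect_squareFunction_sq_le hI hκ zero_le_one hfB
  have hf4 : X.expect (fun x => f x ^ 4) = 1 := by
    rw [← X.expect_const 1]
    exact X.expect_congr fun x hx => by rcases hf x hx with h | h <;> norm_num [h]
  have hq := quadratic_error_le hD2 hγ hd0 hdD hDγ
  have hlow := Finset.sum_le_sum fun i (_ : i ∈ Finset.univ) =>
    X.expect_localInfluence_le hI hκ hf n i ht
  rw [Finset.sum_add_distrib, ← Finset.mul_sum, Finset.sum_const, Finset.card_univ,
    Fintype.card_fin, nsmul_eq_mul, h8, h256, h65536] at hlow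
  have hti : (t ^ 3)⁻¹ = 512 * l ^ 3 := by
    simp only [t]
    field_simp
    norm_num
  have htI : 2 * t * X.totalInfluence f = ε / 4 := by
    rw [hIl]
    simp only [t]
    field_simp
    norm_num
  have herr := influence_error_le hD2 hγ hd0 hdD hDγ hl0.le (hdl.le.trans hdD)
  change _ ≤ 2 * t * X.totalInfluence f + _ at hlow
  rw [htI, hti] at hlow
  rw [hf4, h256] at hmid
  have hmid' : 16 ^ n / M * X.expect (fun x => X.squareFunction f x ^ 2) ≤ ε := by
    calc _ ≤ 16 ^ n / M * 9 := by
          gcongr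
          linarith
      _ = ε := by
          simp only [M]
          field_simp
  have hhigh' : X.expect (fun x => ∑ S : Finset (Fin d),
      if S.card ≤ n then 0 else X.efronStein S f x ^ 2) ≤ ε + ε / 4 := by
    refine le_of_mul_le_mul_left (hhigh.trans ?_) hl0
    rw [h8, hIl, mul_add]
    have : 1 / 100 * (ε / 4) ≤ l * (ε / 4) := by gcongr
    linarith
  -- The budget is `(ε + ε/4) + ε + (ε/4 + ε/4)`, the last `ε/4` being the summed error terms.
  linarith
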